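/- Let $N\ge 1$, let $\Omega\subset\mathbb{R}^N$ be a bounded domain with Lipschitz boundary, let $0<s<1$, and let $\mathcal{C}_\Omega=(0,\infty)\times\Omega$ with lateral boundary $\partial_L\mathcal{C}_\Omega=[0,\infty)\times\partial\Omega$. Let $$H^1_{0,L}(\mathcal{C}_\Omega)=\Big\{v\in L^2(\mathcal{C}_\Omega)\,:\ v=0 \text{ on } \partial_L\mathcal{C}_\Omega,\ \iint_{\mathcal{C}_\Omega}t^{1-2s}|\nabla v(t,x)|^2\,dx\,dt<\infty\Big\},$$ where $\nabla v=(\partial_t v,\nabla_x v)$ is the weak gradient in $\mathcal{C}_\Omega$ and "$v=0$ on $\partial_L\mathcal{C}_\Omega$" means that $v(t,\cdot)\in H^1_0(\Omega)$ for almost every $t>0$; it is endowed with the energy norm $\|v\|=\big(\iint_{\mathcal{C}_\Omega}t^{1-2s}|\nabla v|^2\,dx\,dt\big)^{1/2}$. Put $2^*=\frac{2N}{N-2s}$ if $N>2s$ and $2^*=\infty$ if $N\le 2s$. Then every $v\in H^1_{0,L}(\mathcal{C}_\Omega)$ has a trace $v(0,\cdot)=\lim_{t\to0^+}v(t,\cdot)$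 in $L^2(\Omega)$ (essential limit in $t$), and the linear trace embedding $v\mapsto v(0,\cdot)$ is compact from $H^1_{0,L}(\mathcal{C}_\Omega)$ into $L^2(\Omega)$. Moreover, for every $q\in[2,2^*)$ the trace $v(0,\cdot)$ belongs to $L^q(\Omega)$ and the trace embedding is compact from $H^1_{0,L}(\mathcal{C}_\Omega)$ into $L^q(\Omega)$. -/

import Mathlib

open MeasureTheory Filter Topology Set
open scoped ENNReal ContDiff

noncomputable section

namespace FracTrace

/-- The Euclidean space `ℝ^N`. -/
abbrev Space (N : ℕ) : Type := EuclideanSpace ℝ (Fin N)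

/-- `ℝ × ℝ^N` with its Euclidean norm: the space in which the full gradient
`∇v = (∂ₜ v, ∇ₓ v)` takes its values, so that `‖∇v‖² = |∂ₜ v|² + ‖∇ₓ v‖²`. -/
abbrev GradSpace (N : ℕ) : Type := WithLp 2 (ℝ × Space N)

/-- A bounded domain of `ℝ^N` with Lipschitz boundary: near every boundary point, after choosing
a direction `ν`, the set `Ω` is the region strictly above the graph of a Lipschitz function of
the variables orthogonal to `ν`. -/
structure IsBoundedLipschitzDomain {N : ℕ} (Ω : Set (Space N)) : Prop where
  isOpen : IsOpen Ω
  isConnected : IsConnected Ω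
  isBounded : Bornology.IsBounded Ω
  lipschitz_boundary : ∀ x₀ ∈ frontier Ω, ∃ (ν : Space N) (r : ℝ) (K : NNReal)
    (γ : Space N → ℝ), ‖ν‖ = 1 ∧ 0 < r ∧ LipschitzWith K γ ∧
      ∀ x ∈ Metric.ball x₀ r,
        (x ∈ Ω ↔ γ (x - (inner ℝ x ν : ℝ) • ν) < (inner ℝ x ν : ℝ))

/-- The cylinder `C_Ω = (0, ∞) × Ω`, with points `(t, x)`. -/
def cylinder {N : ℕ} (Ω : Set (Space N)) : Set (ℝ × Space N) := Ioi (0 : ℝ) ×ˢ Ω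

/-- The measure `t^(1-2s) dx dt` on the cylinder. -/
def weightedMeasure {N : ℕ} (s : ℝ) (Ω : Set (Space N)) : Measure (ℝ × Space N) :=
  (volume.restrict (cylinder Ω)).withDensity fun z => ENNReal.ofReal (z.1 ^ (1 - 2 * s))

/-- `φ` belongs to `C_c^∞(U)`. -/
def IsTestFunction {F : Type*} [NormedAddCommGroup F] [NormedSpace ℝ F] (U : Set F)
    (φ : F → ℝ) : Prop :=
  ContDiff ℝ ∞ φ ∧ HasCompactSupport φ ∧ tsupport φ ⊆ U

/-- `g` is the weak gradient of `v` in the open set `U ⊆ ℝ × ℝ^N`. -/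
def IsWeakGradient {N : ℕ} (U : Set (ℝ × Space N)) (v : ℝ × Space N → ℝ)
    (g : ℝ × Space N → GradSpace N) : Prop :=
  ∀ φ : ℝ × Space N → ℝ, IsTestFunction U φ → ∀ e : ℝ × Space N,
    ∫ z in U, v z * fderiv ℝ φ z e = - ∫ z in U, (inner ℝ (g z) (WithLp.toLp 2 e) : ℝ) * φ z

/-- `u ∈ H¹₀(Ω)` and `∇u = w`: in `L²(Ω)`, the pair `(u, w)` is the limit of pairs `(φₙ, ∇φₙ)`
with `φₙ ∈ C_c^∞(Ω)`. -/
def IsH10WithGradient {N : ℕ} (Ω : Set (Space N)) (u : Space N → ℝ) (w : Space N → Space N) :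
    Prop :=
  MemLp u 2 (volume.restrict Ω) ∧ MemLp w 2 (volume.restrict Ω) ∧
  ∃ φ : ℕ → Space N → ℝ, (∀ n, IsTestFunction Ω (φ n)) ∧
    Tendsto (fun n => eLpNorm (fun x => u x - φ n x) 2 (volume.restrict Ω)) atTop (𝓝 0) ∧
    Tendsto (fun n => eLpNorm (fun x => w x - gradient (φ n) x) 2 (volume.restrict Ω))
      atTop (𝓝 0)

/-- Membership in `H¹_{0,L}(C_Ω)` of `v ∈ L²(C_Ω)` with gradient `g ∈ L²(C_Ω, t^(1-2s) dx dt)`: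
`g` is the weak gradient of `v` in the cylinder, and `v = 0` on the lateral boundary, that is,
`v(t, ·) ∈ H¹₀(Ω)` (with gradient `∇ₓ v(t, ·)`) for almost every `t > 0`. -/
structure IsH10L {N : ℕ} (s : ℝ) (Ω : Set (Space N))
    (v : Lp ℝ 2 (volume.restrict (cylinder Ω))) (g : Lp (GradSpace N) 2 (weightedMeasure s Ω)) :
    Prop where
  isWeakGradient : IsWeakGradient (cylinder Ω) v g
  lateral_zero : ∀ᵐ t ∂(volume.restrict (Ioi (0 : ℝ))),
    IsH10WithGradient Ω (fun x => v (t, x)) (fun x => (g (t, x)).snd)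

/-! ### Membership is stable under linear combinations -/

theorem volume_restrict_le_smul_weightedMeasure {N : ℕ} (s : ℝ) {Ω : Set (Space N)}
    {K : Set (ℝ × Space N)} (hK : IsCompact K) (hKU : K ⊆ cylinder Ω) :
    ∃ c : ℝ≥0∞, c ≠ ⊤ ∧ volume.restrict K ≤ c • weightedMeasure s Ω := by
  have hpos : ∀ z ∈ K, 0 < z.1 := fun z hz => (hKU hz).1
  obtain ⟨m, hm, hmK⟩ : ∃ m : ℝ, 0 < m ∧ ∀ z ∈ K, m ≤ z.1 ^ (1 - 2 * s) := by
    rcases K.eq_empty_or_nonempty with rfl | hne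
    · exact ⟨1, one_pos, by simp⟩
    · have hc : ContinuousOn (fun z : ℝ × Space N => z.1 ^ (1 - 2 * s)) K :=
        continuous_fst.continuousOn.rpow_const fun z hz => Or.inl (hpos z hz).ne'
      obtain ⟨z₀, hz₀, hmin⟩ := hK.exists_isMinOn hne hc
      exact ⟨_, Real.rpow_pos_of_pos (hpos z₀ hz₀) _, fun z hz => hmin hz⟩
  have hm0 : ENNReal.ofReal m ≠ 0 := by simpa using hm
  refine ⟨(ENNReal.ofReal m)⁻¹, ENNReal.inv_ne_top.2 hm0, ?_⟩
  have h1 : (ENNReal.ofReal m) • volume.restrict K ≤ weightedMeasure s Ω := by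
    calc (ENNReal.ofReal m) • volume.restrict K
        = (volume.restrict K).withDensity fun _ => ENNReal.ofReal m := (withDensity_const _).symm
      _ ≤ (volume.restrict K).withDensity fun z => ENNReal.ofReal (z.1 ^ (1 - 2 * s)) := by
        refine withDensity_mono ?_
        filter_upwards [ae_restrict_mem hK.measurableSet] with z hz
        exact ENNReal.ofReal_le_ofReal (hmK z hz)
      _ = (weightedMeasure s Ω).restrict K := by
        rw [weightedMeasure, restrict_withDensity hK.measurableSet,
          Measure.restrict_restrict hK.measurableSet, inter_eq_left.2 hKU]
      _ ≤ weightedMeasure s Ω := Measure.restrict_le_self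
  intro A
  have h2 := h1 A
  simp only [Measure.smul_apply, smul_eq_mul] at h2 ⊢
  calc (volume.restrict K) A
      = (ENNReal.ofReal m)⁻¹ * (ENNReal.ofReal m * (volume.restrict K) A) := by
        rw [← mul_assoc, ENNReal.inv_mul_cancel hm0 ENNReal.ofReal_ne_top, one_mul]
    _ ≤ _ := by gcongr

theorem ae_weightedMeasure {N : ℕ} {s : ℝ} {Ω : Set (Space N)} {p : ℝ × Space N → Prop}
    (h : ∀ᵐ z ∂(weightedMeasure s Ω), p z) : ∀ᵐ z ∂(volume.restrict (cylinder Ω)), p z := by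
  have hm : Measurable fun z : ℝ × Space N => ENNReal.ofReal (z.1 ^ (1 - 2 * s)) := by fun_prop
  rw [weightedMeasure, ae_withDensity_iff hm] at h
  have hpos : ∀ᵐ z ∂(volume.restrict (cylinder Ω)), z.1 ∈ Ioi (0 : ℝ) := by
    have h1 : ∀ᵐ z ∂(volume.restrict (Ioi (0 : ℝ) ×ˢ (univ : Set (Space N)))),
        z ∈ Ioi (0 : ℝ) ×ˢ (univ : Set (Space N)) :=
      ae_restrict_mem (measurableSet_Ioi.prod MeasurableSet.univ)
    have h2 : cylinder Ω ⊆ Ioi (0 : ℝ) ×ˢ (univ : Set (Space N)) :=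
      prod_mono le_rfl (subset_univ _)
    filter_upwards [ae_restrict_of_ae_restrict_of_subset h2 h1] with z hz using hz.1
  filter_upwards [h, hpos] with z hz h0
  exact hz (by simpa using Real.rpow_pos_of_pos h0 _)

theorem ae_slice {N : ℕ} {Ω : Set (Space N)} {p : ℝ × Space N → Prop}
    (h : ∀ᵐ z ∂(volume.restrict (cylinder Ω)), p z) :
    ∀ᵐ t ∂(volume.restrict (Ioi (0 : ℝ))), ∀ᵐ x ∂(volume.restrict Ω), p (t, x) := by
  rw [cylinder, Measure.volume_eq_prod, ← Measure.prod_restrict] at h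
  exact Measure.ae_ae_of_ae_prod h

theorem integrable_mul_fderiv {N : ℕ} {Ω : Set (Space N)}
    (v : Lp ℝ 2 (volume.restrict (cylinder Ω))) {φ : ℝ × Space N → ℝ}
    (hφ : IsTestFunction (cylinder Ω) φ) (e : ℝ × Space N) :
    Integrable (fun z => v z * fderiv ℝ φ z e) (volume.restrict (cylinder Ω)) := by
  have hc : Continuous fun z => fderiv ℝ φ z e :=
    (hφ.1.continuous_fderiv (by simp)).clm_apply continuous_const
  have hs : HasCompactSupport fun z => fderiv ℝ φ z e := hφ.2.1.fderiv_apply (𝕜 := ℝ) e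
  exact (Lp.memLp v).integrable_mul (q := 2) (hc.memLp_of_hasCompactSupport hs)

theorem integrable_inner_mul {N : ℕ} {s : ℝ} {Ω : Set (Space N)}
    (g : Lp (GradSpace N) 2 (weightedMeasure s Ω)) {φ : ℝ × Space N → ℝ}
    (hφ : IsTestFunction (cylinder Ω) φ) (e : ℝ × Space N) :
    Integrable (fun z => (inner ℝ (g z) (WithLp.toLp 2 e) : ℝ) * φ z)
      (volume.restrict (cylinder Ω)) := by
  have hK : IsCompact (tsupport φ) := hφ.2.1
  obtain ⟨c, hc, hle⟩ := volume_restrict_le_smul_weightedMeasure s hK hφ.2.2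
  have hg : MemLp g 2 (volume.restrict (tsupport φ)) := (Lp.memLp g).of_measure_le_smul hc hle
  have hφ2 : MemLp φ 2 (volume.restrict (tsupport φ)) :=
    hφ.1.continuous.memLp_of_hasCompactSupport hφ.2.1
  have h : IntegrableOn (fun z => (inner ℝ (g z) (WithLp.toLp 2 e) : ℝ) * φ z)
      (tsupport φ) volume := (hg.inner_const (𝕜 := ℝ) (WithLp.toLp 2 e)).integrable_mul hφ2
  have hsub : Function.support (fun z => (inner ℝ (g z) (WithLp.toLp 2 e) : ℝ) * φ z)
      ⊆ tsupport φ := fun z hz => subset_tsupport φ (right_ne_zero_of_mul hz)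
  exact ((integrableOn_iff_integrable_of_support_subset hsub).1 h).restrict

theorem IsH10WithGradient.congr {N : ℕ} {Ω : Set (Space N)} {u u' : Space N → ℝ}
    {w w' : Space N → Space N} (h : IsH10WithGradient Ω u w)
    (hu : u' =ᵐ[volume.restrict Ω] u) (hw : w' =ᵐ[volume.restrict Ω] w) :
    IsH10WithGradient Ω u' w' := by
  obtain ⟨hmu, hmw, φ, hφ, h1, h2⟩ := h
  refine ⟨hmu.ae_eq hu.symm, hmw.ae_eq hw.symm, φ, hφ, h1.congr fun n => eLpNorm_congr_ae ?_, h2.congr fun n => eLpNorm_congr_ae ?_⟩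
  · filter_upwards [hu] with x hx using by rw [hx]
  · filter_upwards [hw] with x hx using by rw [hx]

theorem IsTestFunction.zero {F : Type*} [NormedAddCommGroup F] [NormedSpace ℝ F] (U : Set F) :
    IsTestFunction U (fun _ => 0) :=
  ⟨contDiff_const, HasCompactSupport.zero, by simp [tsupport]⟩

theorem IsTestFunction.add {F : Type*} [NormedAddCommGroup F] [NormedSpace ℝ F] {U : Set F}
    {φ ψ : F → ℝ} (hφ : IsTestFunction U φ) (hψ : IsTestFunction U ψ) :
    IsTestFunction U (fun x => φ x + ψ x) :=
  ⟨hφ.1.add hψ.1, hφ.2.1.add hψ.2.1,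
    (tsupport_add φ ψ).trans (union_subset hφ.2.2 hψ.2.2)⟩

theorem IsTestFunction.const_mul {F : Type*} [NormedAddCommGroup F] [NormedSpace ℝ F]
    {U : Set F} {φ : F → ℝ} (hφ : IsTestFunction U φ) (c : ℝ) :
    IsTestFunction U (fun x => c * φ x) :=
  ⟨contDiff_const.mul hφ.1, hφ.2.1.mul_left, (tsupport_mul_subset_right).trans hφ.2.2⟩

theorem IsTestFunction.continuous_gradient {N : ℕ} {U : Set (Space N)} {φ : Space N → ℝ}
    (hφ : IsTestFunction U φ) : Continuous (gradient φ) :=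
  (InnerProductSpace.toDual ℝ (Space N)).symm.continuous.comp
    (hφ.1.continuous_fderiv (by simp))

theorem IsTestFunction.differentiableAt {F : Type*} [NormedAddCommGroup F] [NormedSpace ℝ F]
    {U : Set F} {φ : F → ℝ} (hφ : IsTestFunction U φ) (x : F) : DifferentiableAt ℝ φ x :=
  (hφ.1.differentiable (by simp)) x

theorem IsH10WithGradient.zero {N : ℕ} (Ω : Set (Space N)) :
    IsH10WithGradient Ω (fun _ => 0) (fun _ => 0) := by
  refine ⟨MemLp.zero', MemLp.zero', fun _ _ => 0, fun _ => IsTestFunction.zero Ω, ?_, ?_⟩ <;>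
    simp

theorem IsH10WithGradient.add {N : ℕ} {Ω : Set (Space N)} {u u' : Space N → ℝ}
    {w w' : Space N → Space N} (h : IsH10WithGradient Ω u w) (h' : IsH10WithGradient Ω u' w') :
    IsH10WithGradient Ω (fun x => u x + u' x) (fun x => w x + w' x) := by
  obtain ⟨hu, hw, φ, hφ, h1, h2⟩ := h
  obtain ⟨hu', hw', φ', hφ', h1', h2'⟩ := h'
  refine ⟨hu.add hu', hw.add hw', fun n x => φ n x + φ' n x, fun n => (hφ n).add (hφ' n), ?_, ?_⟩
  · refine tendsto_of_tendsto_of_tendsto_of_le_of_le tendsto_const_nhds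
      (by simpa using h1.add h1') (fun _ => zero_le) fun n => ?_
    have e : (fun x => u x + u' x - (φ n x + φ' n x))
        = (fun x => u x - φ n x) + fun x => u' x - φ' n x := by
      funext x; simp only [Pi.add_apply]; ring
    simp only [e]
    exact eLpNorm_add_le (hu.1.sub (hφ n).1.continuous.aestronglyMeasurable)
      (hu'.1.sub (hφ' n).1.continuous.aestronglyMeasurable) one_le_two
  · refine tendsto_of_tendsto_of_tendsto_of_le_of_le tendsto_const_nhds
      (by simpa using h2.add h2') (fun _ => zero_le) fun n => ?_
    have e : (fun x => w x + w' x - gradient (fun x => φ n x + φ' n x) x)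
        = (fun x => w x - gradient (φ n) x) + fun x => w' x - gradient (φ' n) x := by
      funext x
      have : gradient (fun x => φ n x + φ' n x) x = gradient (φ n) x + gradient (φ' n) x := by
        simp only [gradient]
        rw [fderiv_fun_add ((hφ n).differentiableAt x) ((hφ' n).differentiableAt x), map_add]
      rw [this]; simp only [Pi.add_apply]; abel
    simp only [e]
    exact eLpNorm_add_le (hw.1.sub (hφ n).continuous_gradient.aestronglyMeasurable)
      (hw'.1.sub (hφ' n).continuous_gradient.aestronglyMeasurable) one_le_two

theorem IsH10WithGradient.const_smul {N : ℕ} {Ω : Set (Space N)} {u : Space N → ℝ}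
    {w : Space N → Space N} (h : IsH10WithGradient Ω u w) (c : ℝ) :
    IsH10WithGradient Ω (fun x => c * u x) (fun x => c • w x) := by
  obtain ⟨hu, hw, φ, hφ, h1, h2⟩ := h
  refine ⟨hu.const_mul c, hw.const_smul c, fun n x => c * φ n x, fun n => (hφ n).const_mul c,
    ?_, ?_⟩
  · have e : ∀ n, (fun x => c * u x - c * φ n x) = c • fun x => u x - φ n x := fun n => by
      funext x; simp only [Pi.smul_apply, smul_eq_mul]; ring
    simp only [e, eLpNorm_const_smul]
    simpa using ENNReal.Tendsto.const_mul h1 (Or.inr (by simp))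
  · have e : ∀ n, (fun x => c • w x - gradient (fun x => c * φ n x) x)
        = c • fun x => w x - gradient (φ n) x := fun n => by
      funext x
      have : gradient (fun x => c * φ n x) x = c • gradient (φ n) x := by
        simp only [gradient]
        rw [fderiv_const_mul ((hφ n).differentiableAt x), map_smulₛₗ]
        rfl
      rw [this]; simp only [Pi.smul_apply, smul_sub]
    simp only [e, eLpNorm_const_smul]
    simpa using ENNReal.Tendsto.const_mul h2 (Or.inr (by simp))

theorem IsH10L.zero {N : ℕ} (s : ℝ) (Ω : Set (Space N)) : IsH10L s Ω 0 0 := by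
  have hv := Lp.coeFn_zero ℝ 2 (volume.restrict (cylinder Ω))
  have hg := ae_weightedMeasure (Lp.coeFn_zero (GradSpace N) 2 (weightedMeasure s Ω))
  refine ⟨fun φ _ e => ?_, ?_⟩
  · rw [integral_congr_ae (g := fun _ => (0 : ℝ)) (by filter_upwards [hv] with z hz; rw [hz]; simp),
      integral_congr_ae (g := fun _ => (0 : ℝ))
        (f := fun z => (inner ℝ ((0 : Lp (GradSpace N) 2 (weightedMeasure s Ω)) z)
          (WithLp.toLp 2 e) : ℝ) * φ z)
        (by filter_upwards [hg] with z hz; rw [hz]; simp)]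
    simp
  · filter_upwards [ae_slice hv, ae_slice hg] with t h1 h2
    refine (IsH10WithGradient.zero Ω).congr ?_ ?_
    · filter_upwards [h1] with x hx using by rw [hx]; simp
    · filter_upwards [h2] with x hx using by rw [hx]; simp

theorem IsH10L.add {N : ℕ} {s : ℝ} {Ω : Set (Space N)}
    {v v' : Lp ℝ 2 (volume.restrict (cylinder Ω))}
    {g g' : Lp (GradSpace N) 2 (weightedMeasure s Ω)}
    (h : IsH10L s Ω v g) (h' : IsH10L s Ω v' g') : IsH10L s Ω (v + v') (g + g') := by
  have hv := Lp.coeFn_add v v'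
  have hg := ae_weightedMeasure (Lp.coeFn_add g g')
  refine ⟨fun φ hφ e => ?_, ?_⟩
  · have e1 : (fun z => (v + v') z * fderiv ℝ φ z e) =ᵐ[volume.restrict (cylinder Ω)]
        fun z => v z * fderiv ℝ φ z e + v' z * fderiv ℝ φ z e := by
      filter_upwards [hv] with z hz
      rw [hz, Pi.add_apply, add_mul]
    have e2 : (fun z => (inner ℝ ((g + g') z) (WithLp.toLp 2 e) : ℝ) * φ z)
        =ᵐ[volume.restrict (cylinder Ω)]
        fun z => (inner ℝ (g z) (WithLp.toLp 2 e) : ℝ) * φ z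
          + (inner ℝ (g' z) (WithLp.toLp 2 e) : ℝ) * φ z := by
      filter_upwards [hg] with z hz
      rw [hz, Pi.add_apply, inner_add_left, add_mul]
    rw [integral_congr_ae e1, integral_congr_ae e2,
      integral_add (integrable_mul_fderiv v hφ e) (integrable_mul_fderiv v' hφ e),
      integral_add (integrable_inner_mul g hφ e) (integrable_inner_mul g' hφ e),
      h.isWeakGradient φ hφ e, h'.isWeakGradient φ hφ e, neg_add]
  · filter_upwards [ae_slice hv, ae_slice hg, h.lateral_zero, h'.lateral_zero]
      with t h1 h2 h3 h4
    refine (h3.add h4).congr ?_ ?_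
    · filter_upwards [h1] with x hx using by rw [hx]; simp
    · filter_upwards [h2] with x hx using by rw [hx]; simp

theorem IsH10L.const_smul {N : ℕ} {s : ℝ} {Ω : Set (Space N)}
    {v : Lp ℝ 2 (volume.restrict (cylinder Ω))}
    {g : Lp (GradSpace N) 2 (weightedMeasure s Ω)}
    (h : IsH10L s Ω v g) (c : ℝ) : IsH10L s Ω (c • v) (c • g) := by
  have hv := Lp.coeFn_smul c v
  have hg := ae_weightedMeasure (Lp.coeFn_smul c g)
  refine ⟨fun φ hφ e => ?_, ?_⟩
  · have e1 : (fun z => (c • v) z * fderiv ℝ φ z e) =ᵐ[volume.restrict (cylinder Ω)]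
        fun z => c * (v z * fderiv ℝ φ z e) := by
      filter_upwards [hv] with z hz
      rw [hz, Pi.smul_apply, smul_eq_mul, mul_assoc]
    have e2 : (fun z => (inner ℝ ((c • g) z) (WithLp.toLp 2 e) : ℝ) * φ z)
        =ᵐ[volume.restrict (cylinder Ω)]
        fun z => c * ((inner ℝ (g z) (WithLp.toLp 2 e) : ℝ) * φ z) := by
      filter_upwards [hg] with z hz
      rw [hz, Pi.smul_apply, real_inner_smul_left, mul_assoc]
    rw [integral_congr_ae e1, integral_congr_ae e2, integral_const_mul, integral_const_mul,
      h.isWeakGradient φ hφ e, mul_neg]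
  · filter_upwards [ae_slice hv, ae_slice hg, h.lateral_zero] with t h1 h2 h3
    refine (h3.const_smul c).congr ?_ ?_
    · filter_upwards [h1] with x hx using by simp [hx]
    · filter_upwards [h2] with x hx using by simp [hx]

/-! ### The space `H¹_{0,L}(C_Ω)` and its trace -/

/-- The pairs `(v, ∇v)` with `v ∈ H¹_{0,L}(C_Ω)`. The first component determines the second. -/
def H10LSubmodule {N : ℕ} (s : ℝ) (Ω : Set (Space N)) :
    Submodule ℝ (Lp ℝ 2 (volume.restrict (cylinder Ω)) ×
      Lp (GradSpace N) 2 (weightedMeasure s Ω)) where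
  carrier := {p | IsH10L s Ω p.1 p.2}
  zero_mem' := IsH10L.zero s Ω
  add_mem' h h' := IsH10L.add h h'
  smul_mem' c _ h := IsH10L.const_smul h c

/-- The space `H¹_{0,L}(C_Ω)`. It is normed below by the weighted energy alone. -/
def H10L {N : ℕ} (s : ℝ) (Ω : Set (Space N)) : Type := H10LSubmodule s Ω

namespace H10L

instance {N : ℕ} (s : ℝ) (Ω : Set (Space N)) : AddCommGroup (H10L s Ω) :=
  inferInstanceAs (AddCommGroup (H10LSubmodule s Ω))

instance {N : ℕ} (s : ℝ) (Ω : Set (Space N)) : Module ℝ (H10L s Ω) :=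
  inferInstanceAs (Module ℝ (H10LSubmodule s Ω))

/-- The underlying function `v ∈ L²(C_Ω)`. -/
def toL2 {N : ℕ} (s : ℝ) (Ω : Set (Space N)) :
    H10L s Ω →ₗ[ℝ] Lp ℝ 2 (volume.restrict (cylinder Ω)) :=
  LinearMap.fst ℝ _ _ ∘ₗ (H10LSubmodule s Ω).subtype

/-- The gradient `∇v ∈ L²(C_Ω, t^(1-2s) dx dt)`. -/
def grad {N : ℕ} (s : ℝ) (Ω : Set (Space N)) :
    H10L s Ω →ₗ[ℝ] Lp (GradSpace N) 2 (weightedMeasure s Ω) :=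
  LinearMap.snd ℝ _ _ ∘ₗ (H10LSubmodule s Ω).subtype

/-- The energy norm `‖v‖ = (∬ t^(1-2s) |∇v|² dx dt)^(1/2)`. -/
instance {N : ℕ} (s : ℝ) (Ω : Set (Space N)) : SeminormedAddCommGroup (H10L s Ω) :=
  SeminormedAddCommGroup.induced _ _ (grad s Ω)

instance {N : ℕ} (s : ℝ) (Ω : Set (Space N)) : NormedSpace ℝ (H10L s Ω) :=
  NormedSpace.induced ℝ _ _ (grad s Ω)

theorem norm_eq {N : ℕ} (s : ℝ) (Ω : Set (Space N)) (v : H10L s Ω) : ‖v‖ = ‖grad s Ω v‖ := rfl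

theorem isH10L {N : ℕ} (s : ℝ) (Ω : Set (Space N)) (v : H10L s Ω) :
    IsH10L s Ω (toL2 s Ω v) (grad s Ω v) := v.2

end H10L

/-- `f` is the trace of `v` on `{0} × Ω`: `v(t, ·) → f` in `L²(Ω)` as `t → 0⁺`. As `v` is only
given up to null sets, the limit is an essential one, i.e. it is taken along `t` outside some
null set. -/
def IsTrace {N : ℕ} (Ω : Set (Space N)) (v : ℝ × Space N → ℝ) (f : Space N → ℝ) : Prop :=
  Tendsto (fun t : ℝ => eLpNorm (fun x => v (t, x) - f x) 2 (volume.restrict Ω))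
    (𝓝[>] (0 : ℝ) ⊓ ae volume) (𝓝 0)

/-- The critical exponent `2N / (N - 2s)` of the trace embedding, which is `∞` if `N ≤ 2s`. -/
def criticalExponent (N : ℕ) (s : ℝ) : ℝ≥0∞ :=
  if 2 * s < N then ENNReal.ofReal (2 * N / (N - 2 * s)) else ⊤

end FracTrace

end

namespace FracTrace

variable {N : ℕ}

/-! The energy norm controls a fractional smoothness of order `s` of the trace, measured by
translations: the zero extension of `f = v(0, ·)` satisfies `‖f(· + h) - f‖₂ ≤ C ‖v‖ |h|^s`.
Everything else follows from this estimate.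

Two facts about slices give it. Cauchy–Schwarz with the weight split as `t^((1-2s)/2) ·
t^((2s-1)/2)` bounds `∫ |∂ₜv| dt` near `0`, because `t^(2s-1)` is integrable there. Hence the slices
are Cauchy in `L²(Ω)` as `t → 0⁺`, off a null set, and `‖v(t, ·) - f‖₂ ≲ ‖v‖ t^s`
(`exists_ae_eLpNorm_slice_sub_le`, `exists_trace`). On the other hand, averaging the energy over
`(δ, 2δ)` yields a slice with `‖∇ₓv(t, ·)‖₂ ≲ δ^(s-1) ‖v‖` (`exists_slice_gradient_le`), and the
zero extension of an `H¹₀` function moves by at most `|h| ‖∇ₓv(t, ·)‖₂` under translation. With `δ =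
|h|` both errors are of order `|h|^s` (`eLpNorm_translate_sub_le_of_trace`).

A translation longer than the diameter of `Ω` makes the two copies of `f` disjoint, so the same
estimate bounds `‖f‖₂` by `‖v‖`; the trace operator is therefore bounded for the energy norm alone.

For compactness, let `P_k` be averaging over dyadic cubes of side `2⁻ᵏ`. On a bounded set it has
finite rank. The translation estimate gives `‖f - P_k f‖₂ ≲ 2^(-ks)`, while `P_{k+1} f - P_k f` has
supremum norm at most about `2^(kN/2) · 2^(-ks)`. Interpolation makes the increments geometric in
`L^q`, of ratio `2^((N/2)(1-2/q) - s)`, which is less than `1` exactly below the critical exponent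
(`exists_eLpNorm_sub_dyadicAverage_le`). The trace into `L^q` is thus an operator-norm limit of
finite rank operators. -/

/-! ### Dyadic averages and their rate of convergence in `L^q`. -/

theorem eLpNorm_two_sq {α E : Type*} [MeasurableSpace α] [NormedAddCommGroup E]
    (μ : Measure α) (f : α → E) :
    eLpNorm f 2 μ ^ 2 = ∫⁻ x, ‖f x‖ₑ ^ 2 ∂μ := by
  have h := eLpNorm_nnreal_pow_eq_lintegral (f := f) (μ := μ) (p := 2) two_ne_zero
  simpa using h

/-- Jensen's inequality for the square of an average. -/
theorem enorm_smul_integral_sq_le {α : Type*} [MeasurableSpace α] {μ : Measure α} {f : α → ℝ}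
    {c : ℝ} (hf : AEStronglyMeasurable f μ) (hc : ‖c‖ₑ * μ univ ≤ 1) :
    ‖c * ∫ x, f x ∂μ‖ₑ ^ 2 ≤ ‖c‖ₑ * ∫⁻ x, ‖f x‖ₑ ^ 2 ∂μ := by
  have h1 : ‖∫ x, f x ∂μ‖ₑ ≤ eLpNorm f 2 μ * μ univ ^ (1 / 2 : ℝ) := by
    refine (enorm_integral_le_lintegral_enorm f).trans ?_
    rw [← eLpNorm_one_eq_lintegral_enorm]
    refine (eLpNorm_le_eLpNorm_mul_rpow_measure_univ one_le_two hf).trans_eq ?_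
    norm_num
  have h2 : (μ univ ^ (1 / 2 : ℝ)) ^ 2 = μ univ := by
    rw [← ENNReal.rpow_natCast, ← ENNReal.rpow_mul]; norm_num
  calc ‖c * ∫ x, f x ∂μ‖ₑ ^ 2 ≤ (‖c‖ₑ * (eLpNorm f 2 μ * μ univ ^ (1 / 2 : ℝ))) ^ 2 := by
        rw [enorm_mul]; gcongr
    _ = (‖c‖ₑ * μ univ) * (‖c‖ₑ * ∫⁻ x, ‖f x‖ₑ ^ 2 ∂μ) := by
        rw [mul_pow, mul_pow, h2, eLpNorm_two_sq]; ring
    _ ≤ 1 * (‖c‖ₑ * ∫⁻ x, ‖f x‖ₑ ^ 2 ∂μ) := by gcongr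
    _ = _ := one_mul _

/-- Interpolation between `L²` and the supremum norm, from `|f|^q ≤ M^(q-2) |f|²`. -/
theorem eLpNorm_le_of_enorm_le {α : Type*} [MeasurableSpace α] {μ : Measure α} {f : α → ℝ}
    {M : ℝ≥0∞} (hMt : M ≠ ⊤) (hM : ∀ x, ‖f x‖ₑ ≤ M) {q : ℝ} (hq : 2 ≤ q) :
    eLpNorm f (ENNReal.ofReal q) μ ≤ M ^ (1 - 2 / q) * eLpNorm f 2 μ ^ (2 / q) := by
  have hq0 : 0 < q := by linarith
  have h1 : ∫⁻ x, ‖f x‖ₑ ^ q ∂μ ≤ M ^ (q - 2) * eLpNorm f 2 μ ^ 2 := by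
    rw [eLpNorm_two_sq, ← lintegral_const_mul' _ _
      (ENNReal.rpow_ne_top_of_nonneg (by linarith) hMt)]
    refine lintegral_mono fun x => ?_
    have : ‖f x‖ₑ ^ q = ‖f x‖ₑ ^ (q - 2) * ‖f x‖ₑ ^ 2 := by
      rw [← ENNReal.rpow_natCast, ← ENNReal.rpow_add_of_nonneg _ _ (by linarith) (by simp)]
      norm_num
    rw [this]
    gcongr ?_ * _
    exact ENNReal.rpow_le_rpow (hM x) (by linarith)
  rw [eLpNorm_eq_lintegral_rpow_enorm_toReal (by simpa using hq0) ENNReal.ofReal_ne_top,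
    ENNReal.toReal_ofReal hq0.le]
  calc (∫⁻ x, ‖f x‖ₑ ^ q ∂μ) ^ (1 / q) ≤ (M ^ (q - 2) * eLpNorm f 2 μ ^ 2) ^ (1 / q) := by gcongr
    _ = _ := by
      rw [ENNReal.mul_rpow_of_nonneg _ _ (by positivity), ← ENNReal.rpow_mul,
        ← ENNReal.rpow_natCast, ← ENNReal.rpow_mul]
      congr 2
      · field_simp
      · push_cast; ring

/-- The index of the dyadic cube of side `2⁻ᵏ` that contains `x`. -/
noncomputable def dyadicIndex (k : ℕ) (x : Space N) (i : Fin N) : ℤ := ⌊(2 : ℝ) ^ k * x i⌋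

/-- The dyadic cube of side `2⁻ᵏ` with index `m`. -/
noncomputable def dyadicCell (k : ℕ) (m : Fin N → ℤ) : Set (Space N) := dyadicIndex k ⁻¹' {m}

/-- The average of `f` over the dyadic cube of side `2⁻ᵏ` around `x`. -/
noncomputable def dyadicAverage (k : ℕ) (f : Space N → ℝ) (x : Space N) : ℝ :=
  2 ^ (k * N) * ∫ y in dyadicCell k (dyadicIndex k x), f y

theorem measurable_dyadicIndex (k : ℕ) : Measurable (dyadicIndex (N := N) k) := by
  refine measurable_pi_lambda _ fun i => ?_
  unfold dyadicIndex
  fun_prop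

theorem measurableSet_dyadicCell (k : ℕ) (m : Fin N → ℤ) : MeasurableSet (dyadicCell k m) :=
  measurable_dyadicIndex k (MeasurableSet.singleton m)

theorem measurable_dyadicAverage (k : ℕ) (f : Space N → ℝ) : Measurable (dyadicAverage k f) :=
  (measurable_of_countable fun m => 2 ^ (k * N) * ∫ y in dyadicCell k m, f y).comp
    (measurable_dyadicIndex k)

/-- This says that the factor `2^(kN)` in `dyadicAverage` normalizes Lebesgue measure on a cube, in
the form that the hypothesis of `enorm_smul_integral_sq_le` requires. -/
theorem volume_dyadicCell (k : ℕ) (m : Fin N → ℤ) :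
    ‖(2 : ℝ) ^ (k * N)‖ₑ * volume (dyadicCell k m) = 1 := by
  have h : dyadicCell k m = @WithLp.ofLp 2 (Fin N → ℝ) ⁻¹'
      (univ.pi fun i => Ico ((m i : ℝ) / 2 ^ k) ((m i + 1 : ℝ) / 2 ^ k)) := by
    ext x
    simp only [dyadicCell, mem_preimage, mem_singleton_iff, funext_iff, dyadicIndex,
      Int.floor_eq_iff, mem_univ_pi, mem_Ico]
    refine forall_congr' fun i => ?_
    rw [div_le_iff₀ (by positivity), lt_div_iff₀ (by positivity), mul_comm]
  rw [h, (PiLp.volume_preserving_ofLp (Fin N)).measure_preimage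
    (MeasurableSet.univ_pi fun i => measurableSet_Ico).nullMeasurableSet, Real.volume_pi_Ico]
  have : ∀ i, ((m i + 1 : ℝ) / 2 ^ k - (m i : ℝ) / 2 ^ k) = (2 ^ k)⁻¹ := fun i => by
    field_simp; ring
  simp only [this, Finset.prod_const, Finset.card_univ, Fintype.card_fin]
  rw [← ENNReal.ofReal_pow (by positivity), Real.enorm_eq_ofReal (by positivity),
    ← ENNReal.ofReal_mul (by positivity), inv_pow, ← pow_mul,
    mul_inv_cancel₀ (by positivity), ENNReal.ofReal_one]

theorem mem_dyadicCell_self (k : ℕ) (x : Space N) : x ∈ dyadicCell k (dyadicIndex k x) := rfl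

theorem norm_sub_le_of_dyadicIndex_eq {k : ℕ} {x y : Space N}
    (h : dyadicIndex k y = dyadicIndex k x) : ‖y - x‖ ≤ √N * (2 ^ k)⁻¹ := by
  have h1 : ∀ i, ‖(y - x) i‖ ^ 2 ≤ ((2 ^ k : ℝ)⁻¹) ^ 2 := fun i => by
    have h2 : |(2 : ℝ) ^ k * y i - 2 ^ k * x i| < 1 :=
      Int.abs_sub_lt_one_of_floor_eq_floor (congrFun h i)
    rw [← mul_sub, abs_mul, abs_of_pos (by positivity)] at h2
    have h3 : ‖(y - x) i‖ ≤ (2 ^ k : ℝ)⁻¹ := by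
      rw [← one_div, le_div_iff₀ (by positivity), mul_comm]
      simpa using h2.le
    gcongr
  rw [EuclideanSpace.norm_eq]
  calc √(∑ i, ‖(y - x) i‖ ^ 2) ≤ √(∑ _i : Fin N, ((2 ^ k : ℝ)⁻¹) ^ 2) :=
        Real.sqrt_le_sqrt (Finset.sum_le_sum fun i _ => h1 i)
    _ = _ := by
      rw [Finset.sum_const, Finset.card_univ, Fintype.card_fin, nsmul_eq_mul, Real.sqrt_mul
        (by positivity), Real.sqrt_sq (by positivity)]

/-- Dyadic cubes are nested because `⌊a / 2⌋ = ⌊a⌋ / 2` with integer division on the right. -/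
theorem dyadicIndex_eq_of_succ {k : ℕ} {x y : Space N}
    (h : dyadicIndex (k + 1) y = dyadicIndex (k + 1) x) : dyadicIndex k y = dyadicIndex k x := by
  have key : ∀ z : Space N, ∀ i, dyadicIndex k z i = dyadicIndex (k + 1) z i / 2 := fun z i => by
    have := Int.floor_div_natCast ((2 : ℝ) ^ (k + 1) * z i) 2
    simp only [dyadicIndex]
    rw [show (2 : ℝ) ^ k * z i = 2 ^ (k + 1) * z i / (2 : ℕ) by push_cast; ring, this]
    rfl
  funext i
  rw [key, key, h]

/-- Square mean deviation from the dyadic averages. -/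
theorem eLpNorm_sub_dyadicAverage_sq_le {f : Space N → ℝ} (hf : MemLp f 2 volume) (k : ℕ) :
    eLpNorm (fun x => f x - dyadicAverage k f x) 2 volume ^ 2 ≤
      ‖(2 : ℝ) ^ (k * N)‖ₑ * ∫⁻ h in Metric.closedBall (0 : Space N) (√N * (2 ^ k)⁻¹),
        eLpNorm (fun x => f (x + h) - f x) 2 volume ^ 2 := by
  simp only [eLpNorm_two_sq]
  have h1 : ∀ x, ‖f x - dyadicAverage k f x‖ₑ ^ 2 ≤ ‖(2 : ℝ) ^ (k * N)‖ₑ *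
      ∫⁻ h in Metric.closedBall (0 : Space N) (√N * (2 ^ k)⁻¹), ‖f (x + h) - f x‖ₑ ^ 2 := by
    intro x
    set Q := dyadicCell k (dyadicIndex k x)
    have hQ : ‖(2 : ℝ) ^ (k * N)‖ₑ * volume Q = 1 := volume_dyadicCell k _
    have hQt : volume Q ≠ ⊤ := fun h => by simp [h] at hQ
    have hQ' : (2 : ℝ) ^ (k * N) * volume.real Q = 1 := by
      have := congrArg ENNReal.toReal hQ
      simpa [ENNReal.toReal_mul, Measure.real] using this
    have : IsFiniteMeasure (volume.restrict Q) := ⟨by simpa using hQt.lt_top⟩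
    have hint : Integrable f (volume.restrict Q) := (hf.restrict Q).integrable one_le_two
    -- The deviation is itself an average, of `f x - f y` over the cube, so Jensen applies.
    have e : f x - dyadicAverage k f x = 2 ^ (k * N) * ∫ y in Q, (f x - f y) := by
      rw [integral_sub (integrable_const _) hint, setIntegral_const, mul_sub, smul_eq_mul,
        ← mul_assoc, hQ', one_mul]
      rfl
    rw [e]
    refine (enorm_smul_integral_sq_le (aestronglyMeasurable_const.sub hf.1.restrict)
      (by simpa using hQ.le)).trans ?_
    refine mul_le_mul_right ?_ _
    -- Substituting `h = y - x` turns the integral over the cube into one over a ball that no longer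
    -- depends on `x`. This is what permits Fubini afterwards.
    rw [← lintegral_indicator Metric.isClosed_closedBall.measurableSet,
      ← lintegral_indicator (measurableSet_dyadicCell _ _),
      ← lintegral_sub_right_eq_self ((Metric.closedBall _ _).indicator _) x]
    refine lintegral_mono fun y => ?_
    by_cases hy : y ∈ Q
    · have : y - x ∈ Metric.closedBall (0 : Space N) (√N * (2 ^ k)⁻¹) := by
        rw [mem_closedBall_zero_iff]
        exact norm_sub_le_of_dyadicIndex_eq hy
      rw [indicator_of_mem hy, indicator_of_mem this, add_sub_cancel, enorm_sub_rev]
      rfl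
    · rw [indicator_of_notMem hy]; exact zero_le
  refine (lintegral_mono h1).trans_eq ?_
  rw [lintegral_const_mul' _ _ (by simp), lintegral_lintegral_swap]
  have hm : AEStronglyMeasurable (fun p : Space N × Space N => f (p.1 + p.2) - f p.1)
      (volume.prod volume) := by
    refine AEStronglyMeasurable.sub ?_ hf.1.comp_fst
    exact hf.1.comp_quasiMeasurePreserving (quasiMeasurePreserving_add _ _)
  have hm2 : AEMeasurable (Function.uncurry fun x h : Space N => ‖f (x + h) - f x‖ₑ ^ 2)
      (volume.prod volume) := hm.enorm.pow_const 2
  refine hm2.mono_measure ?_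
  exact Measure.prod_mono le_rfl Measure.restrict_le_self

/-- Consecutive dyadic averages differ little in the supremum norm. -/
theorem enorm_dyadicAverage_succ_sub_sq_le {f : Space N → ℝ} (hf : MemLp f 2 volume) (k : ℕ)
    (x : Space N) :
    ‖dyadicAverage (k + 1) f x - dyadicAverage k f x‖ₑ ^ 2 ≤
      ‖(2 : ℝ) ^ ((k + 1) * N)‖ₑ *
        eLpNorm (fun x => f x - dyadicAverage k f x) 2 volume ^ 2 := by
  rw [eLpNorm_two_sq]
  set Q := dyadicCell (k + 1) (dyadicIndex (k + 1) x)
  have hQ : ‖(2 : ℝ) ^ ((k + 1) * N)‖ₑ * volume Q = 1 := volume_dyadicCell (k + 1) _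
  have hQt : volume Q ≠ ⊤ := fun h => by simp [h] at hQ
  have hQ' : (2 : ℝ) ^ ((k + 1) * N) * volume.real Q = 1 := by
    have := congrArg ENNReal.toReal hQ
    simpa [ENNReal.toReal_mul, Measure.real] using this
  have : IsFiniteMeasure (volume.restrict Q) := ⟨by simpa using hQt.lt_top⟩
  have hint : Integrable f (volume.restrict Q) := (hf.restrict Q).integrable one_le_two
  -- The coarse average is constant on the fine cube, so the increment is the fine average of `f -
  -- P_k f`; Jensen then bounds it pointwise by an `L²` norm.
  have hc : ∀ y ∈ Q, dyadicAverage k f y = dyadicAverage k f x := fun y hy => by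
    simp only [dyadicAverage, dyadicIndex_eq_of_succ (show dyadicIndex (k + 1) y = _ from hy)]
  have e : dyadicAverage (k + 1) f x - dyadicAverage k f x
      = 2 ^ ((k + 1) * N) * ∫ y in Q, (f y - dyadicAverage k f y) := by
    rw [setIntegral_congr_fun (measurableSet_dyadicCell _ _)
      (g := fun y => f y - dyadicAverage k f x) (fun y hy => by simp only [hc y hy]),
      integral_sub hint (integrable_const _), setIntegral_const, mul_sub, smul_eq_mul,
      ← mul_assoc, hQ', one_mul]
    rfl
  rw [e]
  refine (enorm_smul_integral_sq_le (hf.1.restrict.sub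
    (measurable_dyadicAverage k f).aestronglyMeasurable) (by simpa using hQ.le)).trans ?_
  refine mul_le_mul_right ?_ _
  exact lintegral_mono' Measure.restrict_le_self le_rfl

/-- Only translations with `|h| ≤ √N 2⁻ᵏ` enter the mean deviation, each costing at most `A (√N
2⁻ᵏ)^s`. The volume of the ball of these `h` is `2^(-kN) V`, which cancels the normalizing factor
and leaves a constant. -/
theorem exists_eLpNorm_two_sub_dyadicAverage_le (N : ℕ) {s : ℝ} (hs : 0 ≤ s) :
    ∃ K : ℝ, 0 ≤ K ∧ ∀ (f : Space N → ℝ) (A : ℝ), 0 ≤ A → MemLp f 2 volume →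
      (∀ h : Space N, eLpNorm (fun x => f (x + h) - f x) 2 volume ≤
        ENNReal.ofReal (A * ‖h‖ ^ s)) →
      ∀ k, eLpNorm (fun x => f x - dyadicAverage k f x) 2 volume ≤
        ENNReal.ofReal (K * A * ((2 : ℝ) ^ (-s)) ^ k) := by
  set V : ℝ := volume.real (Metric.closedBall (0 : Space N) (√N))
  refine ⟨√V * √N ^ s, by positivity, fun f A hA hf hfh k => ?_⟩
  rw [← ENNReal.pow_le_pow_left_iff two_ne_zero]
  refine (eLpNorm_sub_dyadicAverage_sq_le hf k).trans ?_
  have hr : (√N * (2 ^ k)⁻¹) ^ s = √N ^ s * ((2 : ℝ) ^ (-s)) ^ k := by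
    rw [Real.mul_rpow (by positivity) (by positivity), Real.inv_rpow (by positivity),
      ← Real.rpow_natCast, ← Real.rpow_natCast, ← Real.rpow_mul (by positivity),
      ← Real.rpow_mul (by positivity), ← Real.rpow_neg (by positivity)]
    congr 2; ring
  have hvol : ‖(2 : ℝ) ^ (k * N)‖ₑ *
      volume (Metric.closedBall (0 : Space N) (√N * (2 ^ k)⁻¹)) = ENNReal.ofReal V := by
    rw [mul_comm √(N : ℝ), Measure.addHaar_closedBall_mul _ _ (by positivity) (by positivity),
      finrank_euclideanSpace, Fintype.card_fin, Real.enorm_eq_ofReal (by positivity), ← mul_assoc,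
      ← ENNReal.ofReal_mul (by positivity), pow_mul, ← mul_pow,
      mul_inv_cancel₀ (by positivity), one_pow, ENNReal.ofReal_one, one_mul,
      ofReal_measureReal (measure_closedBall_lt_top.ne)]
  calc ‖(2 : ℝ) ^ (k * N)‖ₑ * ∫⁻ h in Metric.closedBall (0 : Space N) (√N * (2 ^ k)⁻¹),
        eLpNorm (fun x => f (x + h) - f x) 2 volume ^ 2
      ≤ ‖(2 : ℝ) ^ (k * N)‖ₑ * ∫⁻ h in Metric.closedBall (0 : Space N) (√N * (2 ^ k)⁻¹),
        ENNReal.ofReal (A * (√N * (2 ^ k)⁻¹) ^ s) ^ 2 := by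
        refine mul_le_mul_right ?_ _
        refine setLIntegral_mono measurable_const fun h hh => ?_
        have := hfh h
        rw [mem_closedBall_zero_iff] at hh
        gcongr
        refine this.trans ?_
        gcongr
    _ = _ := by
        rw [setLIntegral_const, mul_comm (ENNReal.ofReal _ ^ 2), ← mul_assoc, hvol, hr,
          ← ENNReal.ofReal_pow (by positivity), ← ENNReal.ofReal_mul (by positivity),
          ← ENNReal.ofReal_pow (by positivity)]
        congr 1
        rw [mul_pow, mul_pow, mul_pow, mul_pow, mul_pow, Real.sq_sqrt (by positivity)]
        ring

/-- Smoothness of order `s` in `L²` gives convergence of the dyadic averages in `L^q` with a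
geometric rate, for every `q ≥ 2` below the critical exponent `2N / (N - 2s)`. -/
theorem exists_eLpNorm_sub_dyadicAverage_le (N : ℕ) {s q : ℝ} (hs : 0 < s) (hq : 2 ≤ q)
    (hqs : (N / 2 : ℝ) * (1 - 2 / q) < s) :
    ∃ K ρ : ℝ, 0 ≤ K ∧ 0 ≤ ρ ∧ ρ < 1 ∧ ∀ (f : Space N → ℝ) (A : ℝ), 0 ≤ A → MemLp f 2 volume →
      (∀ h : Space N, eLpNorm (fun x => f (x + h) - f x) 2 volume ≤
        ENNReal.ofReal (A * ‖h‖ ^ s)) →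
      ∀ k, eLpNorm (fun x => f x - dyadicAverage k f x) (ENNReal.ofReal q) volume ≤
        ENNReal.ofReal (K * A * ρ ^ k) := by
  obtain ⟨K, hK, hKf⟩ := exists_eLpNorm_two_sub_dyadicAverage_le N hs.le
  set σ : ℝ := (2 : ℝ) ^ (-s)
  set θ : ℝ := 2 / q
  have hθ0 : 0 ≤ θ := by positivity
  have hθ1 : 0 ≤ 1 - θ := by
    rw [sub_nonneg, div_le_one (by linarith)]; exact hq
  set b : ℝ := √(2 ^ N) ^ (1 - θ)
  have hσ0 : 0 < σ := by positivity
  have hσ1 : σ < 1 := Real.rpow_lt_one_of_one_lt_of_neg one_lt_two (by linarith)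
  have hb0 : 0 < b := by positivity
  set ρ : ℝ := b * σ
  have hρ0 : 0 < ρ := by positivity
  -- `ρ` combines the growth `2^(N/2)` of the supremum bound, weighted by `1 - θ`, with the decay
  -- `2^(-s)`; the hypothesis `hqs` says that decay wins.
  have hρ1 : ρ < 1 := by
    have : ρ = 2 ^ ((N / 2 : ℝ) * (1 - θ) - s) := by
      simp only [ρ, b, σ]
      rw [Real.sqrt_eq_rpow, ← Real.rpow_natCast, ← Real.rpow_mul (by positivity),
        ← Real.rpow_mul (by positivity), ← Real.rpow_add (by positivity)]
      congr 1; ring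
    rw [this]
    exact Real.rpow_lt_one_of_one_lt_of_neg one_lt_two (by linarith)
  have h1ρ : 0 < 1 - ρ := by linarith
  set C : ℝ := 2 ^ θ * b * K
  have hC : 0 ≤ C := by positivity
  refine ⟨C / (1 - ρ), ρ, by positivity, hρ0.le, hρ1, fun f A hA hf hfh k => ?_⟩
  have hE := hKf f A hA hf hfh
  have hmeas : ∀ k, AEStronglyMeasurable (dyadicAverage k f) volume :=
    fun k => (measurable_dyadicAverage k f).aestronglyMeasurable
  have hD : ∀ k, eLpNorm (fun x => dyadicAverage (k + 1) f x - dyadicAverage k f x)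
      (ENNReal.ofReal q) volume ≤ ENNReal.ofReal (C * A * ρ ^ k) := by
    intro k
    have hsup : ∀ x, ‖dyadicAverage (k + 1) f x - dyadicAverage k f x‖ₑ ≤
        ENNReal.ofReal (√(2 ^ N) ^ (k + 1) * (K * A * σ ^ k)) := by
      intro x
      rw [← ENNReal.pow_le_pow_left_iff two_ne_zero]
      refine (enorm_dyadicAverage_succ_sub_sq_le hf k x).trans ?_
      rw [ENNReal.ofReal_mul (by positivity), mul_pow]
      gcongr ?_ * ?_
      · rw [Real.enorm_eq_ofReal (by positivity), ← ENNReal.ofReal_pow (by positivity)]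
        apply ENNReal.ofReal_le_ofReal
        rw [← pow_mul √((2 : ℝ) ^ N), mul_comm (k + 1) 2, pow_mul √((2 : ℝ) ^ N),
          Real.sq_sqrt (by positivity), ← pow_mul, mul_comm N]
      · have := hE k
        gcongr
    have hL2 : eLpNorm (fun x => dyadicAverage (k + 1) f x - dyadicAverage k f x) 2 volume ≤
        ENNReal.ofReal (2 * (K * A * σ ^ k)) := by
      have e : (fun x => dyadicAverage (k + 1) f x - dyadicAverage k f x) =
          (fun x => f x - dyadicAverage k f x) - fun x => f x - dyadicAverage (k + 1) f x := by
        funext x; simp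
      rw [e]
      refine (eLpNorm_sub_le (hf.1.sub (hmeas _)) (hf.1.sub (hmeas _)) one_le_two).trans ?_
      refine (add_le_add (hE k) (hE (k + 1))).trans ?_
      rw [← ENNReal.ofReal_add (by positivity) (by positivity)]
      apply ENNReal.ofReal_le_ofReal
      have : K * A * σ ^ (k + 1) ≤ K * A * σ ^ k := by
        gcongr ?_ * ?_
        exact pow_le_pow_of_le_one hσ0.le hσ1.le (Nat.le_succ k)
      linarith
    refine (eLpNorm_le_of_enorm_le ENNReal.ofReal_ne_top hsup hq).trans ?_
    calc _ ≤ ENNReal.ofReal (√(2 ^ N) ^ (k + 1) * (K * A * σ ^ k)) ^ (1 - θ) *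
          ENNReal.ofReal (2 * (K * A * σ ^ k)) ^ θ := by gcongr
      _ = _ := by
        rw [ENNReal.ofReal_rpow_of_nonneg (by positivity) hθ1,
          ENNReal.ofReal_rpow_of_nonneg (by positivity) hθ0, ← ENNReal.ofReal_mul (by positivity)]
        congr 1
        have hx : 0 ≤ K * A * σ ^ k := by positivity
        have hxx : (K * A * σ ^ k) ^ (1 - θ) * (K * A * σ ^ k) ^ θ = K * A * σ ^ k := by
          rw [← Real.rpow_add_of_nonneg hx hθ1 hθ0]; simp
        have hbk : (√(2 ^ N) ^ (k + 1)) ^ (1 - θ) = b ^ (k + 1) := by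
          rw [← Real.rpow_natCast, ← Real.rpow_mul (by positivity), mul_comm,
            Real.rpow_mul (by positivity), Real.rpow_natCast]
        rw [Real.mul_rpow (by positivity) hx, Real.mul_rpow two_pos.le hx, hbk]
        calc _ = b ^ (k + 1) * 2 ^ θ *
              ((K * A * σ ^ k) ^ (1 - θ) * (K * A * σ ^ k) ^ θ) := by ring
          _ = _ := by rw [hxx]; simp only [C, ρ]; ring
  -- Telescoping sum of the increments; the exact difference `ρ^k - ρ^j` is kept so that the
  -- induction closes.
  have hsum : ∀ j, k ≤ j → eLpNorm (fun x => dyadicAverage j f x - dyadicAverage k f x)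
      (ENNReal.ofReal q) volume ≤ ENNReal.ofReal (C / (1 - ρ) * A * (ρ ^ k - ρ ^ j)) := by
    intro j hj
    induction j, hj using Nat.le_induction with
    | base => simp
    | succ j hj ih =>
      have e : (fun x => dyadicAverage (j + 1) f x - dyadicAverage k f x) =
          (fun x => dyadicAverage (j + 1) f x - dyadicAverage j f x) +
            fun x => dyadicAverage j f x - dyadicAverage k f x := by
        funext x; simp
      have hkj : 0 ≤ ρ ^ k - ρ ^ j := sub_nonneg.2 (pow_le_pow_of_le_one hρ0.le hρ1.le hj)
      rw [e]
      refine (eLpNorm_add_le ((hmeas _).sub (hmeas _)) ((hmeas _).sub (hmeas _))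
        (by rw [ENNReal.one_le_ofReal]; linarith)).trans ?_
      refine (add_le_add (hD j) ih).trans_eq ?_
      rw [← ENNReal.ofReal_add (by positivity) (by positivity)]
      congr 1
      field_simp
      ring
  have hlim : Tendsto (fun j => eLpNorm (dyadicAverage j f - f) 2 volume) atTop (𝓝 0) := by
    have h0 : Tendsto (fun j => ENNReal.ofReal (K * A * σ ^ j)) atTop (𝓝 0) := by
      rw [← ENNReal.ofReal_zero]
      refine ENNReal.tendsto_ofReal ?_
      simpa using (tendsto_pow_atTop_nhds_zero_of_lt_one hσ0.le hσ1).const_mul (K * A)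
    refine tendsto_of_tendsto_of_tendsto_of_le_of_le tendsto_const_nhds h0
      (fun _ => zero_le) fun j => ?_
    rw [eLpNorm_sub_comm]
    exact hE j
  -- Only `L²` convergence to `f` is known at this point. A subsequence converges almost everywhere,
  -- and Fatou carries the uniform `L^q` bound to the limit.
  obtain ⟨ns, hns, hae⟩ := (tendstoInMeasure_of_tendsto_eLpNorm two_ne_zero hmeas hf.1
    hlim).exists_seq_tendsto_ae
  refine (Lp.eLpNorm_lim_le_liminf_eLpNorm
    -- The shift by `k` ensures `k ≤ j + k ≤ ns (j + k)`, so that `hsum` applies for every `j`.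
    (f := fun j x => dyadicAverage (ns (j + k)) f x - dyadicAverage k f x)
    (fun j => (hmeas _).sub (hmeas _)) _ ?_).trans ?_
  · filter_upwards [hae] with x hx
    exact (hx.comp (tendsto_add_atTop_nat k)).sub_const _
  · refine liminf_le_of_frequently_le' (Frequently.of_forall fun j => ?_)
    refine (hsum _ ((Nat.le_add_left k j).trans (hns.id_le _))).trans ?_
    apply ENNReal.ofReal_le_ofReal
    gcongr
    exact sub_le_self _ (by positivity)

/-! ### Translation estimates for functions in `H¹₀`. -/

theorem eLpNorm_comp_add_right {E : Type*} [NormedAddCommGroup E] (f : Space N → E)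
    (hf : AEStronglyMeasurable f volume) (h : Space N) :
    eLpNorm (fun x => f (x + h)) 2 volume = eLpNorm f 2 volume :=
  eLpNorm_comp_measurePreserving hf (measurePreserving_add_right volume h)

/-- The increment is the integral of the directional derivative along the segment from `x` to `x +
h`; Jensen in the segment parameter, Fubini and translation invariance give the bound. -/
theorem IsTestFunction.eLpNorm_translate_sub_le {U : Set (Space N)} {φ : Space N → ℝ}
    (hφ : IsTestFunction U φ) (h : Space N) :
    eLpNorm (fun x => φ (x + h) - φ x) 2 volume ≤ ‖h‖ₑ * eLpNorm (gradient φ) 2 volume := by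
  rw [← ENNReal.pow_le_pow_left_iff two_ne_zero, mul_pow, eLpNorm_two_sq]
  have hc : Continuous fun p : Space N × ℝ => gradient φ (p.1 + p.2 • h) :=
    hφ.continuous_gradient.comp (by fun_prop)
  have hc' : ∀ x, Continuous fun t : ℝ => fderiv ℝ φ (x + t • h) h := fun x =>
    ((hφ.1.continuous_fderiv (by simp)).comp (by fun_prop)).clm_apply continuous_const
  have h1 : ∀ x, ‖φ (x + h) - φ x‖ₑ ^ 2 ≤
      ∫⁻ t in Ioc (0 : ℝ) 1, ‖h‖ₑ ^ 2 * ‖gradient φ (x + t • h)‖ₑ ^ 2 := by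
    intro x
    have hd : ∀ t ∈ uIcc (0 : ℝ) 1,
        HasDerivAt (fun t : ℝ => φ (x + t • h)) (fderiv ℝ φ (x + t • h) h) t := by
      intro t _
      have h2 : HasDerivAt (fun t : ℝ => x + t • h) h t := by
        simpa using ((hasDerivAt_id t).smul_const h).const_add x
      exact (hφ.differentiableAt _).hasFDerivAt.comp_hasDerivAt t h2
    have h3 := intervalIntegral.integral_eq_sub_of_hasDerivAt hd
      ((hc' x).intervalIntegrable 0 1)
    simp only [one_smul, zero_smul, add_zero] at h3
    rw [← h3, intervalIntegral.integral_of_le zero_le_one]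
    have h4 := enorm_smul_integral_sq_le (μ := volume.restrict (Ioc (0 : ℝ) 1)) (c := 1)
      (f := fun t => fderiv ℝ φ (x + t • h) h) (hc' x).aestronglyMeasurable (by simp)
    rw [one_mul, enorm_one, one_mul] at h4
    refine h4.trans (lintegral_mono fun t => ?_)
    rw [← mul_pow]
    have h5 : fderiv ℝ φ (x + t • h) h = inner ℝ (gradient φ (x + t • h)) h := by
      simp [gradient]
    rw [h5]
    gcongr
    rw [← ofReal_norm, ← ofReal_norm, ← ofReal_norm, ← ENNReal.ofReal_mul (norm_nonneg _)]
    apply ENNReal.ofReal_le_ofReal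
    rw [mul_comm]
    exact norm_inner_le_norm _ _
  refine (lintegral_mono h1).trans ?_
  rw [lintegral_lintegral_swap]
  · have h6 : ∀ t : ℝ, ∫⁻ x, ‖h‖ₑ ^ 2 * ‖gradient φ (x + t • h)‖ₑ ^ 2 =
        ‖h‖ₑ ^ 2 * eLpNorm (gradient φ) 2 volume ^ 2 := fun t => by
      rw [lintegral_const_mul' _ _ (by simp), eLpNorm_two_sq]
      congr 1
      exact lintegral_add_right_eq_self (fun x => ‖gradient φ x‖ₑ ^ 2) (t • h)
    simp only [h6]
    simp
  · refine AEMeasurable.const_mul ?_ _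
    exact (hc.enorm.measurable.pow_const 2).aemeasurable

theorem IsTestFunction.support_gradient_subset {U : Set (Space N)} {φ : Space N → ℝ}
    (hφ : IsTestFunction U φ) : Function.support (gradient φ) ⊆ U := by
  intro x hx
  refine hφ.2.2 (support_fderiv_subset ℝ (f := φ) fun h0 => hx ?_)
  simp [gradient, h0]

/-- The zero extension of an `H¹₀` function is Lipschitz under translations in `L²`. -/
theorem IsH10WithGradient.eLpNorm_translate_sub_le {Ω : Set (Space N)} (hΩ : MeasurableSet Ω)
    {u : Space N → ℝ} {w : Space N → Space N} (hu : IsH10WithGradient Ω u w) (h : Space N) :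
    eLpNorm (fun x => Ω.indicator u (x + h) - Ω.indicator u x) 2 volume ≤
      ‖h‖ₑ * eLpNorm w 2 (volume.restrict Ω) := by
  obtain ⟨hmu, hmw, φ, hφ, h1, h2⟩ := hu
  set d : ℕ → ℝ≥0∞ := fun n => eLpNorm (fun x => u x - φ n x) 2 (volume.restrict Ω)
  set d' : ℕ → ℝ≥0∞ := fun n => eLpNorm (fun x => w x - gradient (φ n) x) 2 (volume.restrict Ω)
  have hum : AEStronglyMeasurable (Ω.indicator u) volume :=
    (aestronglyMeasurable_indicator_iff hΩ).2 hmu.1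
  have key : ∀ n, eLpNorm (fun x => Ω.indicator u (x + h) - Ω.indicator u x) 2 volume ≤
      d n + ‖h‖ₑ * (eLpNorm w 2 (volume.restrict Ω) + d' n) + d n := by
    intro n
    have hφm := (hφ n).1.continuous.aestronglyMeasurable (μ := volume)
    -- As `φ n` vanishes off `Ω`, the error of the zero extension on the whole space is the error in
    -- `L²(Ω)`. No boundary term appears.
    set r : Space N → ℝ := fun x => Ω.indicator u x - φ n x
    have hr : AEStronglyMeasurable r volume := hum.sub hφm
    have hrd : eLpNorm r 2 volume = d n := by
      have : r = Ω.indicator fun x => u x - φ n x := by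
        funext x
        by_cases hx : x ∈ Ω
        · simp [r, hx]
        · have : φ n x = 0 := image_eq_zero_of_notMem_tsupport fun h => hx ((hφ n).2.2 h)
          simp [r, hx, this]
      rw [this, eLpNorm_indicator_eq_eLpNorm_restrict hΩ]
    have e : (fun x => Ω.indicator u (x + h) - Ω.indicator u x) =
        (fun x => r (x + h)) + (fun x => φ n (x + h) - φ n x) - r := by
      funext x; simp [r]
    have hrh : AEStronglyMeasurable (fun x => r (x + h)) volume :=
      hr.comp_measurePreserving (measurePreserving_add_right volume h)
    have hφh : AEStronglyMeasurable (fun x => φ n (x + h) - φ n x) volume :=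
      (hφm.comp_measurePreserving (measurePreserving_add_right volume h)).sub hφm
    rw [e]
    refine (eLpNorm_sub_le (hrh.add hφh) hr one_le_two).trans ?_
    rw [hrd]
    refine add_le_add_left ((eLpNorm_add_le hrh hφh one_le_two).trans ?_) _
    rw [eLpNorm_comp_add_right r hr, hrd]
    refine add_le_add_right (((hφ n).eLpNorm_translate_sub_le h).trans ?_) _
    refine mul_le_mul_right ?_ _
    rw [← eLpNorm_restrict_eq_of_support_subset (hφ n).support_gradient_subset]
    have e2 : gradient (φ n) = w - fun x => w x - gradient (φ n) x := by
      funext x; simp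
    conv_lhs => rw [e2]
    exact eLpNorm_sub_le hmw.1 (hmw.1.sub (hφ n).continuous_gradient.aestronglyMeasurable)
      one_le_two
  have hd'' : Tendsto (fun n => ‖h‖ₑ * (eLpNorm w 2 (volume.restrict Ω) + d' n)) atTop
      (𝓝 (‖h‖ₑ * (eLpNorm w 2 (volume.restrict Ω) + 0))) :=
    ENNReal.Tendsto.const_mul (tendsto_const_nhds.add h2) (Or.inr (by simp))
  exact ge_of_tendsto' (by simpa using (h1.add hd'').add h1) key

/-! ### Testing the weak derivative in `t`. -/

/-- A smoothed indicator function of `[t₁, t₂]`. -/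
theorem exists_contDiff_cutoff (ρ : ContDiffBump (0 : ℝ)) {t₁ t₂ : ℝ} (h12 : t₁ ≤ t₂) :
    ∃ η : ℝ → ℝ, ContDiff ℝ ∞ η ∧ tsupport η ⊆ Icc (t₁ - ρ.rOut) (t₂ + ρ.rOut) ∧
      (∀ τ, ‖η τ‖ ≤ 1) ∧
      ∀ τ, HasDerivAt η (ρ.normed volume (t₁ - τ) - ρ.normed volume (t₂ - τ)) τ := by
  set r : ℝ → ℝ := ρ.normed volume
  have hrc : Continuous r := ρ.continuous_normed
  set F : ℝ → ℝ := fun x => ∫ y in (0 : ℝ)..x, r y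
  have hF : ∀ x, HasDerivAt F (r x) x := fun x =>
    intervalIntegral.integral_hasDerivAt_right (hrc.intervalIntegrable _ _)
      hrc.aestronglyMeasurable.stronglyMeasurableAtFilter hrc.continuousAt
  have hFs : ContDiff ℝ ∞ F := by
    rw [contDiff_infty_iff_deriv]
    refine ⟨fun x => (hF x).differentiableAt, ?_⟩
    rw [funext fun x => (hF x).deriv]
    exact ρ.contDiff_normed
  have hsub : ∀ a b, F b - F a = ∫ y in a..b, r y := fun a b =>
    intervalIntegral.integral_interval_sub_left (hrc.intervalIntegrable _ _)
      (hrc.intervalIntegrable _ _)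
  have hzero : ∀ y, ρ.rOut ≤ |y| → r y = 0 := fun y hy => by
    have : y ∉ Function.support r := by
      rw [ρ.support_normed_eq]
      simpa using hy
    simpa using this
  -- With `F` a primitive of the mollifier, this is the mollifier's mass between `τ - t₂` and `τ -
  -- t₁`. Since the mollifier is even, its derivative is the difference of the kernels of
  -- convolution at `t₁` and `t₂`.
  refine ⟨fun τ => F (τ - t₁) - F (τ - t₂), by fun_prop, ?_, fun τ => ?_, fun τ => ?_⟩
  · refine closure_minimal (fun τ hτ => ?_) isClosed_Icc
    by_contra hc
    rw [mem_Icc, not_and_or, not_le, not_le] at hc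
    refine hτ ?_
    change F (τ - t₁) - F (τ - t₂) = 0
    rw [hsub]
    refine intervalIntegral.integral_zero_ae (ae_of_all _ fun y hy => hzero y ?_)
    rw [uIoc_of_le (by linarith)] at hy
    rcases hc with hc | hc
    · rw [abs_of_nonpos (by linarith [hy.2, ρ.rOut_pos])]; linarith [hy.2]
    · exact le_abs.2 (Or.inl (by linarith [hy.1]))
  · simp only [hsub]
    rw [intervalIntegral.integral_of_le (by linarith), Real.norm_of_nonneg
      (integral_nonneg fun y => ρ.nonneg_normed y), ← ρ.integral_normed (μ := volume)]
    exact setIntegral_le_integral ρ.integrable_normed (ae_of_all _ fun y => ρ.nonneg_normed y)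
  · have h := ((hF (τ - t₁)).comp_sub_const τ t₁).sub ((hF (τ - t₂)).comp_sub_const τ t₂)
    have e : ∀ t, r (τ - t) = r (t - τ) := fun t => by
      rw [← neg_sub]; exact ρ.normed_neg _
    rw [e, e] at h
    exact h

theorem IsTestFunction.prod_mul {Ω : Set (Space N)} {η : ℝ → ℝ} {ψ : Space N → ℝ}
    (hη : IsTestFunction (Ioi (0 : ℝ)) η) (hψ : IsTestFunction Ω ψ) :
    IsTestFunction (cylinder Ω) fun z => η z.1 * ψ z.2 := by
  have hsub : tsupport (fun z : ℝ × Space N => η z.1 * ψ z.2) ⊆ tsupport η ×ˢ tsupport ψ := by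
    refine closure_minimal (fun z hz => ?_) ((isClosed_tsupport η).prod (isClosed_tsupport ψ))
    exact ⟨subset_tsupport _ (left_ne_zero_of_mul hz), subset_tsupport _ (right_ne_zero_of_mul hz)⟩
  refine ⟨(hη.1.comp contDiff_fst).mul (hψ.1.comp contDiff_snd), ?_,
    hsub.trans (prod_mono hη.2.2 hψ.2.2)⟩
  exact (hη.2.1.isCompact.prod hψ.2.1.isCompact).of_isClosed_subset (isClosed_tsupport _) hsub

theorem fderiv_prod_mul_apply {η η' : ℝ → ℝ} {ψ : Space N → ℝ} {Ω : Set (Space N)}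
    (hη' : ∀ t, HasDerivAt η (η' t) t) (hψ : IsTestFunction Ω ψ) (z : ℝ × Space N) :
    fderiv ℝ (fun z : ℝ × Space N => η z.1 * ψ z.2) z (1, 0) = η' z.1 * ψ z.2 := by
  have h2 : HasFDerivAt (fun z : ℝ × Space N => η z.1) _ z :=
    (hη' z.1).hasFDerivAt.comp z hasFDerivAt_fst
  have h3 : HasFDerivAt (fun z : ℝ × Space N => ψ z.2) _ z :=
    (hψ.differentiableAt z.2).hasFDerivAt.comp z hasFDerivAt_snd
  rw [(h2.fun_mul h3).fderiv]
  simp [mul_comm]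

/-- The weak gradient identity for product test functions in the direction `(1, 0)`, which isolates
`∂ₜv`. -/
theorem IsWeakGradient.integral_deriv_mul {Ω : Set (Space N)} {v : ℝ × Space N → ℝ}
    {g : ℝ × Space N → GradSpace N} (h : IsWeakGradient (cylinder Ω) v g) {η η' : ℝ → ℝ}
    {ψ : Space N → ℝ} (hη : IsTestFunction (Ioi (0 : ℝ)) η) (hη' : ∀ t, HasDerivAt η (η' t) t)
    (hψ : IsTestFunction Ω ψ) :
    ∫ z in cylinder Ω, v z * (η' z.1 * ψ z.2) =
      -∫ z in cylinder Ω, (g z).fst * (η z.1 * ψ z.2) := by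
  have h1 := h _ (hη.prod_mul hψ) (1, 0)
  have e2 : ∀ z, (inner ℝ (g z) (WithLp.toLp 2 ((1 : ℝ), (0 : Space N))) : ℝ) = (g z).fst :=
    fun z => by simp [WithLp.prod_inner_apply]
  simpa only [fderiv_prod_mul_apply hη' hψ, e2] using h1

theorem lintegral_rpow_Ioc {b s : ℝ} (hb : 0 ≤ b) (hs : 0 < s) :
    ∫⁻ t in Ioc 0 b, ENNReal.ofReal (t ^ (2 * s - 1)) = ENNReal.ofReal (b ^ (2 * s) / (2 * s)) := by
  have hint : IntervalIntegrable (fun t : ℝ => t ^ (2 * s - 1)) volume 0 b :=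
    intervalIntegral.intervalIntegrable_rpow' (by linarith)
  rw [← ofReal_integral_eq_lintegral_ofReal, ← intervalIntegral.integral_of_le hb,
    integral_rpow (Or.inl (by linarith)), sub_add_cancel, Real.zero_rpow (by positivity), sub_zero]
  · exact (intervalIntegrable_iff_integrableOn_Ioc_of_le hb).1 hint
  · filter_upwards [ae_restrict_mem measurableSet_Ioc] with t ht
    exact Real.rpow_nonneg ht.1.le _

theorem ae_restrict_cylinder_mem {Ω : Set (Space N)} (hΩ : MeasurableSet Ω) :
    ∀ᵐ z ∂(volume.restrict (cylinder Ω)), z ∈ cylinder Ω :=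
  ae_restrict_mem (measurableSet_Ioi.prod hΩ)

theorem volume_restrict_cylinder (Ω : Set (Space N)) :
    volume.restrict (cylinder Ω) = (volume.restrict (Ioi (0 : ℝ))).prod (volume.restrict Ω) := by
  rw [cylinder, Measure.volume_eq_prod, ← Measure.prod_restrict]

theorem lintegral_weightedMeasure {s : ℝ} {Ω : Set (Space N)} {f : ℝ × Space N → ℝ≥0∞}
    (hf : Measurable f) :
    ∫⁻ z, f z ∂(weightedMeasure s Ω) =
      ∫⁻ z in cylinder Ω, ENNReal.ofReal (z.1 ^ (1 - 2 * s)) * f z := by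
  rw [weightedMeasure, lintegral_withDensity_eq_lintegral_mul _ (by fun_prop) hf]
  rfl

/-- Cauchy–Schwarz after inserting `1 = t^((1-2s)/2) · t^((2s-1)/2)`. The first factor completes `g`
to the weighted energy; the square of the second is integrable on `(0, b]` because `s > 0`, and this
produces the gain `b^s`. -/
theorem enorm_integral_fst_mul_le {s : ℝ} (hs : 0 < s) {Ω : Set (Space N)}
    (hΩ : MeasurableSet Ω) {g : ℝ × Space N → GradSpace N} (hg : StronglyMeasurable g)
    {η : ℝ → ℝ} {b : ℝ} (hb : 0 ≤ b) (hη1 : ∀ t, ‖η t‖ ≤ 1) (hηb : ∀ t, b < t → η t = 0)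
    (hηm : Measurable η) {ψ : Space N → ℝ} (hψ : Measurable ψ) :
    ‖∫ z in cylinder Ω, (g z).fst * (η z.1 * ψ z.2)‖ₑ ≤
      eLpNorm g 2 (weightedMeasure s Ω) *
        (ENNReal.ofReal √(b ^ (2 * s) / (2 * s)) * eLpNorm ψ 2 (volume.restrict Ω)) := by
  set w₁ : ℝ × Space N → ℝ≥0∞ := fun z => ENNReal.ofReal (z.1 ^ ((1 - 2 * s) / 2))
  set w₂ : ℝ × Space N → ℝ≥0∞ := fun z => ENNReal.ofReal (z.1 ^ ((2 * s - 1) / 2))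
  set G : ℝ × Space N → ℝ≥0∞ := fun z => ‖g z‖ₑ * w₁ z
  set H : ℝ × Space N → ℝ≥0∞ := fun z => w₂ z * ‖η z.1 * ψ z.2‖ₑ
  have hw₁ : Measurable w₁ := by fun_prop
  have hw₂ : Measurable w₂ := by fun_prop
  have hGm : Measurable G := hg.measurable.enorm.mul hw₁
  have hHm : Measurable H := hw₂.mul
    ((hηm.comp measurable_fst).mul (hψ.comp measurable_snd)).enorm
  have h1 : ‖∫ z in cylinder Ω, (g z).fst * (η z.1 * ψ z.2)‖ₑ ≤ ∫⁻ z in cylinder Ω, G z * H z := by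
    refine (enorm_integral_le_lintegral_enorm _).trans (lintegral_mono_ae ?_)
    filter_upwards [ae_restrict_cylinder_mem hΩ] with z hz
    have hz0 : 0 < z.1 := hz.1
    have hw : w₁ z * w₂ z = 1 := by
      simp only [w₁, w₂]
      rw [← ENNReal.ofReal_mul (by positivity), ← Real.rpow_add hz0]
      ring_nf; simp
    have h2 : G z * H z = ‖g z‖ₑ * ‖η z.1 * ψ z.2‖ₑ := by
      calc G z * H z = (w₁ z * w₂ z) * (‖g z‖ₑ * ‖η z.1 * ψ z.2‖ₑ) := by
            simp only [G, H]; ring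
        _ = _ := by rw [hw, one_mul]
    rw [h2, enorm_mul]
    gcongr
    rw [← ofReal_norm, ← ofReal_norm]
    exact ENNReal.ofReal_le_ofReal (WithLp.norm_fst_le _ _)
  have hG : ∫⁻ z in cylinder Ω, G z ^ 2 = eLpNorm g 2 (weightedMeasure s Ω) ^ 2 := by
    rw [eLpNorm_two_sq, lintegral_weightedMeasure (hg.measurable.enorm.pow_const 2)]
    refine lintegral_congr_ae ?_
    filter_upwards [ae_restrict_cylinder_mem hΩ] with z hz
    have hz0 : 0 < z.1 := hz.1
    simp only [G, w₁]
    rw [mul_pow, mul_comm, ← ENNReal.ofReal_pow (by positivity), ← Real.rpow_natCast,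
      ← Real.rpow_mul hz0.le]
    congr 3
    push_cast; ring
  have hH : ∫⁻ z in cylinder Ω, H z ^ 2 ≤
      (ENNReal.ofReal √(b ^ (2 * s) / (2 * s)) * eLpNorm ψ 2 (volume.restrict Ω)) ^ 2 := by
    rw [mul_pow, ← ENNReal.ofReal_pow (by positivity), Real.sq_sqrt (by positivity),
      ← lintegral_rpow_Ioc hb hs, eLpNorm_two_sq,
      ← lintegral_indicator measurableSet_Ioc]
    have h3 : ∫⁻ t, (Ioc 0 b).indicator (fun t => ENNReal.ofReal (t ^ (2 * s - 1))) t =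
        ∫⁻ t in Ioi 0, (Ioc 0 b).indicator (fun t => ENNReal.ofReal (t ^ (2 * s - 1))) t := by
      rw [setLIntegral_indicator measurableSet_Ioc, lintegral_indicator measurableSet_Ioc,
        inter_eq_left.2 (fun t ht => ht.1)]
    rw [h3, ← lintegral_prod_mul, ← volume_restrict_cylinder]
    · refine lintegral_mono_ae ?_
      filter_upwards [ae_restrict_cylinder_mem hΩ] with z hz
      have hz0 : 0 < z.1 := hz.1
      by_cases hzb : z.1 ≤ b
      · rw [indicator_of_mem (show z.1 ∈ Ioc 0 b from ⟨hz0, hzb⟩)]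
        simp only [H, w₂]
        rw [mul_pow, enorm_mul, mul_pow, ← ENNReal.ofReal_pow (by positivity),
          ← Real.rpow_natCast, ← Real.rpow_mul hz0.le]
        have e : (2 * s - 1) / 2 * ((2 : ℕ) : ℝ) = 2 * s - 1 := by push_cast; ring
        rw [e]
        gcongr
        have h5 : ‖η z.1‖ₑ ≤ 1 := by
          rw [← ofReal_norm, ← ENNReal.ofReal_one]
          exact ENNReal.ofReal_le_ofReal (hη1 _)
        calc ‖η z.1‖ₑ ^ 2 * ‖ψ z.2‖ₑ ^ 2 ≤ 1 ^ 2 * ‖ψ z.2‖ₑ ^ 2 := by gcongr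
          _ = _ := by simp
      · simp [H, hηb _ (not_le.1 hzb)]
    · exact (Measurable.indicator (by fun_prop) measurableSet_Ioc).aemeasurable
    · exact (hψ.enorm.pow_const 2).aemeasurable
  refine h1.trans ?_
  refine (ENNReal.lintegral_mul_le_Lp_mul_Lq _ Real.HolderConjugate.two_two hGm.aemeasurable
    hHm.aemeasurable).trans ?_
  have hrp : ∀ a : ℝ≥0∞, (a ^ 2) ^ (1 / 2 : ℝ) = a := fun a => by
    rw [← ENNReal.rpow_natCast, ← ENNReal.rpow_mul]; norm_num
  gcongr
  · rw [← hrp (eLpNorm g 2 _), ← hG]; simp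
  · rw [← hrp (_ * _)]
    gcongr
    simpa using hH

/-! ### Hölder continuity of the slices and existence of the trace. -/

theorem setIntegral_cylinder {Ω : Set (Space N)} {F : ℝ × Space N → ℝ}
    (hF : Integrable F (volume.restrict (cylinder Ω))) :
    ∫ z in cylinder Ω, F z = ∫ t in Ioi (0 : ℝ), ∫ x in Ω, F (t, x) := by
  rw [volume_restrict_cylinder] at hF ⊢
  exact integral_prod _ hF

/-- The pairing is extended by zero to `t ≤ 0` because mollification takes place on the whole line.
-/
theorem locallyIntegrable_indicator_integral_mul {Ω : Set (Space N)}
    [IsFiniteMeasure (volume.restrict Ω)]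
    {v : ℝ × Space N → ℝ} (hv : MemLp v 2 (volume.restrict (cylinder Ω))) {ψ : Space N → ℝ}
    (hψ : MemLp ψ 2 (volume.restrict Ω)) :
    LocallyIntegrable ((Ioi (0 : ℝ)).indicator fun t => ∫ x in Ω, v (t, x) * ψ x) volume := by
  rw [locallyIntegrable_iff]
  intro K hK
  rw [IntegrableOn, integrable_indicator_iff measurableSet_Ioi, IntegrableOn,
    Measure.restrict_restrict measurableSet_Ioi]
  have : IsFiniteMeasure (volume.restrict (Ioi 0 ∩ K)) :=
    ⟨by simpa using (measure_mono inter_subset_right).trans_lt hK.measure_lt_top⟩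
  have h1 : (volume.restrict (Ioi (0 : ℝ) ∩ K)).prod (volume.restrict Ω) ≤
      volume.restrict (cylinder Ω) := by
    rw [volume_restrict_cylinder]
    exact Measure.prod_mono (Measure.restrict_mono inter_subset_left le_rfl) le_rfl
  exact ((hv.mono_measure h1).integrable_mul (q := 2) (hψ.comp_snd _)).integral_prod_left

theorem IsTestFunction.memLp {Ω : Set (Space N)} {ψ : Space N → ℝ} (hψ : IsTestFunction Ω ψ)
    (p : ℝ≥0∞) (μ : Measure (Space N)) [IsFiniteMeasureOnCompacts μ] : MemLp ψ p μ :=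
  hψ.1.continuous.memLp_of_hasCompactSupport hψ.2.1

/-- Bumps concentrating at the origin. -/
noncomputable def shrinkingBump (n : ℕ) : ContDiffBump (0 : ℝ) where
  rIn := 1 / (2 * (n + 1))
  rOut := 1 / (n + 1)
  rIn_pos := by positivity
  rIn_lt_rOut := by
    apply one_div_lt_one_div_of_lt <;> linarith [n.cast_nonneg (α := ℝ)]

theorem tendsto_rOut_shrinkingBump :
    Tendsto (fun n => (shrinkingBump n).rOut) atTop (𝓝 0) :=
  tendsto_one_div_add_atTop_nhds_zero_nat

/-- Pairings of the slices `v(t, ·)` with a test function are Hölder continuous in `t`. -/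
theorem exists_ae_enorm_integral_slice_sub_le {s : ℝ} (hs : 0 < s) {Ω : Set (Space N)}
    (hΩ : MeasurableSet Ω) [IsFiniteMeasure (volume.restrict Ω)] (v : H10L s Ω)
    {ψ : Space N → ℝ} (hψ : IsTestFunction Ω ψ) :
    ∃ G ∈ ae (volume : Measure ℝ), ∀ t₁ ∈ G, ∀ t₂ ∈ G, 0 < t₁ → t₁ < t₂ →
      ‖(∫ x in Ω, H10L.toL2 s Ω v (t₁, x) * ψ x) - ∫ x in Ω, H10L.toL2 s Ω v (t₂, x) * ψ x‖ₑ ≤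
        ‖v‖ₑ * (ENNReal.ofReal √((2 * t₂) ^ (2 * s) / (2 * s)) *
          eLpNorm ψ 2 (volume.restrict Ω)) := by
  set u := H10L.toL2 s Ω v
  set g := H10L.grad s Ω v
  have hvu := H10L.isH10L s Ω v
  set V : ℝ → ℝ := fun t => ∫ x in Ω, u (t, x) * ψ x
  have hV : LocallyIntegrable ((Ioi (0 : ℝ)).indicator V) volume :=
    locallyIntegrable_indicator_integral_mul (Lp.memLp u) (hψ.memLp 2 _)
  -- Lebesgue differentiation: mollifications of the pairing converge to it off a null set, which
  -- defines the good set. `K = 2` is the fixed ratio of outer to inner radius of the bumps.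
  have hae := ContDiffBump.ae_convolution_tendsto_right_of_locallyIntegrable (μ := volume)
    tendsto_rOut_shrinkingBump (K := 2)
    (Eventually.of_forall fun n => by simp only [shrinkingBump]; field_simp; rfl) hV
  refine ⟨_, hae, fun t₁ h₁ t₂ h₂ h0 h12 => ?_⟩
  simp only [mem_ofPred_eq] at h₁ h₂
  rw [indicator_of_mem (show t₁ ∈ Ioi 0 from h0)] at h₁
  rw [indicator_of_mem (show t₂ ∈ Ioi 0 from h0.trans h12)] at h₂
  refine le_of_tendsto (h₁.sub h₂).enorm ?_
  filter_upwards [tendsto_rOut_shrinkingBump.eventually_lt_const h0] with n hn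
  set ρ := shrinkingBump n
  have hconv : ConvolutionExists (ρ.normed volume) ((Ioi (0 : ℝ)).indicator V)
      (ContinuousLinearMap.lsmul ℝ ℝ) volume :=
    ρ.hasCompactSupport_normed.convolutionExists_left _ ρ.continuous_normed hV
  obtain ⟨η, hηs, hηt, hη1, hη'⟩ := exists_contDiff_cutoff ρ h12.le
  set η' : ℝ → ℝ := fun τ => ρ.normed volume (t₁ - τ) - ρ.normed volume (t₂ - τ)
  have hηtest : IsTestFunction (Ioi (0 : ℝ)) η :=
    ⟨hηs, HasCompactSupport.of_support_subset_isCompact isCompact_Icc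
      ((subset_tsupport η).trans hηt), fun t ht => by
        have := (hηt ht).1
        simp only [mem_Ioi]; linarith⟩
  -- The difference of the mollified pairings at `t₁` and `t₂` is `∫ v η'(t) ψ(x)`, to which the
  -- weak derivative in `t` applies.
  have key : convolution (ρ.normed volume) ((Ioi (0 : ℝ)).indicator V)
        (ContinuousLinearMap.lsmul ℝ ℝ) volume t₁ -
      convolution (ρ.normed volume) ((Ioi (0 : ℝ)).indicator V)
        (ContinuousLinearMap.lsmul ℝ ℝ) volume t₂ =
      -∫ z in cylinder Ω, (g z).fst * (η z.1 * ψ z.2) := by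
    rw [convolution_eq_swap, convolution_eq_swap,
      ← integral_sub (hconv t₁).integrable_swap (hconv t₂).integrable_swap,
      ← hvu.isWeakGradient.integral_deriv_mul hηtest hη' hψ]
    have hi := integrable_mul_fderiv u (hηtest.prod_mul hψ) (1, 0)
    simp only [fderiv_prod_mul_apply hη' hψ] at hi
    refine Eq.trans ?_ (setIntegral_cylinder hi).symm
    rw [← integral_indicator measurableSet_Ioi]
    refine integral_congr_ae (ae_of_all _ fun t => ?_)
    by_cases ht : t ∈ Ioi (0 : ℝ)
    · simp only [indicator_of_mem ht, ContinuousLinearMap.lsmul_apply, smul_eq_mul, V]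
      rw [← sub_mul, ← integral_const_mul]
      refine integral_congr_ae (ae_of_all _ fun x => ?_)
      ring
    · simp [indicator_of_notMem ht]
  rw [key, enorm_neg]
  have h2t : 0 ≤ 2 * t₂ := by linarith
  -- The cutoff is supported below `t₂ + rOut < t₂ + t₁ < 2 t₂`, whence the endpoint `2 * t₂`.
  refine (enorm_integral_fst_mul_le hs hΩ (Lp.stronglyMeasurable g) h2t hη1 (fun t ht => ?_)
    hηs.continuous.measurable hψ.1.continuous.measurable).trans_eq ?_
  · refine image_eq_zero_of_notMem_tsupport fun h => ?_
    have := (hηt h).2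
    linarith
  · rw [← Lp.enorm_def]
    rfl

/-- Test functions are dense in `L²(Ω)`. -/
theorem dense_testFunction {Ω : Set (Space N)} (hΩ : IsOpen Ω)
    [IsFiniteMeasure (volume.restrict Ω)] :
    Dense {f : Lp ℝ 2 (volume.restrict Ω) |
      ∃ ψ, IsTestFunction Ω ψ ∧ f =ᵐ[volume.restrict Ω] ψ} := by
  let S : Submodule ℝ (Lp ℝ 2 (volume.restrict Ω)) :=
    { carrier := {f | ∃ ψ, IsTestFunction Ω ψ ∧ f =ᵐ[volume.restrict Ω] ψ}
      zero_mem' := ⟨_, IsTestFunction.zero Ω, Lp.coeFn_zero _ _ _⟩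
      add_mem' := by
        rintro f f' ⟨ψ, hψ, h⟩ ⟨ψ', hψ', h'⟩
        refine ⟨_, hψ.add hψ', ?_⟩
        filter_upwards [Lp.coeFn_add f f', h, h'] with x h1 h2 h3
        rw [h1, Pi.add_apply, h2, h3]
      smul_mem' := by
        rintro c f ⟨ψ, hψ, h⟩
        refine ⟨_, hψ.const_mul c, ?_⟩
        filter_upwards [Lp.coeFn_smul c f, h] with x h1 h2
        rw [h1, Pi.smul_apply, h2, smul_eq_mul] }
  change Dense (S : Set (Lp ℝ 2 (volume.restrict Ω)))
  -- By the fundamental lemma of the calculus of variations, only zero is orthogonal to all test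
  -- functions.
  rw [Submodule.dense_iff_topologicalClosure_eq_top, Submodule.topologicalClosure_eq_top_iff,
    Submodule.eq_bot_iff]
  intro u hu
  have hloc : LocallyIntegrableOn u Ω volume :=
    IntegrableOn.locallyIntegrableOn ((Lp.memLp u).integrable one_le_two)
  have h0 := hΩ.ae_eq_zero_of_integral_contDiff_smul_eq_zero hloc fun ψ h1 h2 h3 => by
    have hψ : IsTestFunction Ω ψ := ⟨h1, h2, h3⟩
    have hm : MemLp ψ 2 (volume.restrict Ω) := hψ.memLp 2 _
    have h4 := (Submodule.mem_orthogonal S u).1 hu (hm.toLp ψ) ⟨ψ, hψ, hm.coeFn_toLp⟩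
    rw [L2.inner_def] at h4
    rw [← setIntegral_eq_integral_of_forall_compl_eq_zero (s := Ω), ← h4]
    · refine integral_congr_ae ?_
      filter_upwards [hm.coeFn_toLp] with x hx
      rw [hx]; simp [mul_comm]
    · intro x hx
      rw [image_eq_zero_of_notMem_tsupport fun h => hx (h3 h), zero_smul]
  rw [Lp.eq_zero_iff_ae_eq_zero]
  exact (ae_restrict_iff' hΩ.measurableSet).2 h0

/-- The slices `v(t, ·)` are Hölder continuous in `t` with values in `L²(Ω)`, off a null set. -/
theorem exists_ae_eLpNorm_slice_sub_le {s : ℝ} (hs : 0 < s) {Ω : Set (Space N)}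
    (hΩ : IsOpen Ω) [IsFiniteMeasure (volume.restrict Ω)] (v : H10L s Ω) :
    ∃ G ∈ ae (volume : Measure ℝ),
      (∀ t ∈ G, 0 < t → MemLp (fun x => H10L.toL2 s Ω v (t, x)) 2 (volume.restrict Ω)) ∧
      ∀ t₁ ∈ G, ∀ t₂ ∈ G, 0 < t₁ → t₁ < t₂ →
        eLpNorm (fun x => H10L.toL2 s Ω v (t₁, x) - H10L.toL2 s Ω v (t₂, x)) 2
          (volume.restrict Ω) ≤ ENNReal.ofReal (‖v‖ * ((2 * t₂) ^ s / √(2 * s))) := by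
  have : Fact ((2 : ℝ≥0∞) ≠ ⊤) := ⟨ENNReal.ofNat_ne_top⟩
  -- The exceptional null set depends on the test function. A countable dense family makes the union
  -- of these sets null and still determines the `L²` norm by duality.
  obtain ⟨D, hDS, hDc, hD⟩ := (dense_testFunction hΩ).exists_countable_dense_subset
  have hex : ∀ f ∈ D, ∃ G ∈ ae (volume : Measure ℝ), ∃ ψ, IsTestFunction Ω ψ ∧
      f =ᵐ[volume.restrict Ω] ψ ∧ ∀ t₁ ∈ G, ∀ t₂ ∈ G, 0 < t₁ → t₁ < t₂ →
      ‖(∫ x in Ω, H10L.toL2 s Ω v (t₁, x) * ψ x) - ∫ x in Ω, H10L.toL2 s Ω v (t₂, x) * ψ x‖ₑ ≤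
        ‖v‖ₑ * (ENNReal.ofReal √((2 * t₂) ^ (2 * s) / (2 * s)) *
          eLpNorm ψ 2 (volume.restrict Ω)) := fun f hf => by
    obtain ⟨ψ, hψ, hfψ⟩ := hDS hf
    obtain ⟨G, hG, h⟩ := exists_ae_enorm_integral_slice_sub_le hs hΩ.measurableSet v hψ
    exact ⟨G, hG, ψ, hψ, hfψ, h⟩
  choose! G hG ψ hψ hfψ hGψ using hex
  have hmem : ∀ᵐ t : ℝ, 0 < t → MemLp (fun x => H10L.toL2 s Ω v (t, x)) 2 (volume.restrict Ω) := by
    have := (ae_restrict_iff' measurableSet_Ioi).1 (H10L.isH10L s Ω v).lateral_zero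
    filter_upwards [this] with t ht h0 using (ht h0).1
  refine ⟨_, inter_mem hmem ((countable_bInter_mem hDc).2 hG), fun t ht => ht.1,
    fun t₁ h₁ t₂ h₂ h0 h12 => ?_⟩
  have hm₁ := h₁.1 h0
  have hm₂ := h₂.1 (h0.trans h12)
  have hm := hm₁.sub hm₂
  set B : ℝ := ‖v‖ * ((2 * t₂) ^ s / √(2 * s))
  have hR : √((2 * t₂) ^ (2 * s) / (2 * s)) = (2 * t₂) ^ s / √(2 * s) := by
    have h2t : 0 ≤ 2 * t₂ := by linarith
    rw [Real.sqrt_div (by positivity), mul_comm 2 s, Real.rpow_mul h2t]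
    norm_cast
    rw [Real.sqrt_sq (by positivity)]
  have h2t : 0 < 2 * t₂ := by linarith
  have hB : 0 ≤ B := by positivity
  set w : Lp ℝ 2 (volume.restrict Ω) := hm.toLp _
  have hDw : ∀ f ∈ D, ‖(inner ℝ w f : ℝ)‖ ≤ B * ‖f‖ := by
    intro f hf
    have h3 := hGψ f hf t₁ (mem_iInter₂.1 h₁.2 f hf) t₂ (mem_iInter₂.1 h₂.2 f hf) h0 h12
    have hψm : MemLp (ψ f) 2 (volume.restrict Ω) := (hψ f hf).memLp 2 _
    have e : (inner ℝ w f : ℝ) = (∫ x in Ω, H10L.toL2 s Ω v (t₁, x) * ψ f x) -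
        ∫ x in Ω, H10L.toL2 s Ω v (t₂, x) * ψ f x := by
      have hi₁ : Integrable (fun x => H10L.toL2 s Ω v (t₁, x) * ψ f x) (volume.restrict Ω) :=
        hm₁.integrable_mul hψm
      have hi₂ : Integrable (fun x => H10L.toL2 s Ω v (t₂, x) * ψ f x) (volume.restrict Ω) :=
        hm₂.integrable_mul hψm
      rw [L2.inner_def, ← integral_sub hi₁ hi₂]
      refine integral_congr_ae ?_
      filter_upwards [hm.coeFn_toLp, hfψ f hf] with x h4 h5
      rw [h4, h5]
      simp only [Pi.sub_apply, RCLike.inner_apply, conj_trivial]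
      ring
    rw [← e, hR, ← eLpNorm_congr_ae (hfψ f hf), ← Lp.enorm_def, ← ofReal_norm, ← ofReal_norm,
      ← ofReal_norm, ← ENNReal.ofReal_mul (by positivity), ← ENNReal.ofReal_mul (by positivity),
      ENNReal.ofReal_le_ofReal_iff (by positivity), ← mul_assoc] at h3
    exact h3
  have hall : ∀ f, ‖(inner ℝ w f : ℝ)‖ ≤ B * ‖f‖ := by
    have hcl : IsClosed {f : Lp ℝ 2 (volume.restrict Ω) | ‖(inner ℝ w f : ℝ)‖ ≤ B * ‖f‖} :=
      isClosed_le (by fun_prop) (by fun_prop)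
    intro f
    exact closure_minimal hDw hcl (hD f)
  -- The bound on the functional is tested on `w` itself.
  have hw : ‖w‖ ≤ B := by
    have := hall w
    rw [real_inner_self_eq_norm_sq, Real.norm_of_nonneg (by positivity), sq] at this
    by_contra hc
    rw [not_le] at hc
    have := le_of_mul_le_mul_right this (hB.trans_lt hc)
    linarith
  have h6 : eLpNorm (fun x => H10L.toL2 s Ω v (t₁, x) - H10L.toL2 s Ω v (t₂, x)) 2
      (volume.restrict Ω) = ‖w‖ₑ := by
    rw [Lp.enorm_def]
    exact (eLpNorm_congr_ae hm.coeFn_toLp).symm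
  rw [h6, ← ofReal_norm]
  exact ENNReal.ofReal_le_ofReal hw

/-- Existence of the trace, with a rate of convergence. -/
theorem exists_trace {s : ℝ} (hs : 0 < s) {Ω : Set (Space N)}
    (hΩ : IsOpen Ω) [IsFiniteMeasure (volume.restrict Ω)] (v : H10L s Ω) :
    ∃ f : Lp ℝ 2 (volume.restrict Ω), ∀ᵐ t : ℝ, 0 < t →
      eLpNorm (fun x => H10L.toL2 s Ω v (t, x) - f x) 2 (volume.restrict Ω) ≤
        ENNReal.ofReal (‖v‖ * ((2 * t) ^ s / √(2 * s))) := by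
  obtain ⟨G, hG, hmem, hGle⟩ := exists_ae_eLpNorm_slice_sub_le hs hΩ v
  set B : ℝ → ℝ := fun t => ‖v‖ * ((2 * t) ^ s / √(2 * s))
  have hBmono : ∀ a b, 0 < a → a ≤ b → B a ≤ B b := fun a b ha hab => by
    simp only [B]; gcongr
  -- Good times tending to zero exist because every interval `(0, ε)` meets a conull set. The slices
  -- there form a Cauchy sequence, whose limit is the trace.
  have hex : ∀ n : ℕ, ∃ t ∈ G, 0 < t ∧ t < 1 / ((n : ℝ) + 1) := fun n => by
    have h1 : (volume.restrict (Ioo (0 : ℝ) (1 / ((n : ℝ) + 1)))) ≠ 0 := by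
      rw [Ne, Measure.restrict_eq_zero, Real.volume_Ioo]
      simp; positivity
    have := ae_neBot.2 h1
    obtain ⟨t, ht, ht'⟩ := ((ae_restrict_of_ae (s := Ioo (0 : ℝ) (1 / ((n : ℝ) + 1)))
      (show ∀ᵐ t : ℝ, t ∈ G from hG)).and (ae_restrict_mem measurableSet_Ioo)).exists
    exact ⟨t, ht, ht'.1, ht'.2⟩
  choose τ hτG hτ0 hτ1 using hex
  let U : ∀ t : G, 0 < (t : ℝ) → Lp ℝ 2 (volume.restrict Ω) := fun t ht =>
    (hmem t t.2 ht).toLp _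
  have hUlt : ∀ (a b : G) (ha : 0 < (a : ℝ)) (hb : 0 < (b : ℝ)), (a : ℝ) < b →
      dist (U a ha) (U b hb) ≤ B b := fun a b ha hb hab => by
    have h2t : 0 < 2 * (b : ℝ) := by linarith
    rw [Lp.dist_def]
    refine ENNReal.toReal_le_of_le_ofReal (by positivity) ?_
    refine (eLpNorm_congr_ae ?_).trans_le (hGle a a.2 b b.2 ha hab)
    filter_upwards [(hmem a a.2 ha).coeFn_toLp, (hmem b b.2 hb).coeFn_toLp] with x h1 h2
    simp only [U, Pi.sub_apply, h1, h2]
  have hUle : ∀ (a b : G) (ha : 0 < (a : ℝ)) (hb : 0 < (b : ℝ)) (c : ℝ), (a : ℝ) ≤ c → (b : ℝ) ≤ c →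
      dist (U a ha) (U b hb) ≤ B c := fun a b ha hb c hac hbc => by
    rcases lt_trichotomy (a : ℝ) b with h | h | h
    · exact (hUlt a b ha hb h).trans (hBmono _ _ hb hbc)
    · obtain rfl := Subtype.ext h
      have h2t : 0 < 2 * c := by linarith
      rw [dist_self]; positivity
    · rw [dist_comm]
      exact (hUlt b a hb ha h).trans (hBmono _ _ ha hac)
  have hB0 : Tendsto (fun n : ℕ => B (1 / ((n : ℝ) + 1))) atTop (𝓝 0) := by
    have h1 : Tendsto B (𝓝 0) (𝓝 (‖v‖ * ((2 * 0) ^ s / √(2 * s)))) := by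
      refine Tendsto.const_mul _ (Tendsto.div_const ?_ _)
      exact (tendsto_id.const_mul 2).rpow_const (Or.inr hs.le)
    rw [mul_zero, Real.zero_rpow hs.ne', zero_div, mul_zero] at h1
    exact h1.comp tendsto_one_div_add_atTop_nhds_zero_nat
  have hcau : CauchySeq fun n => U ⟨τ n, hτG n⟩ (hτ0 n) := by
    refine cauchySeq_of_le_tendsto_0 _ (fun n m k hkn hkm => hUle _ _ (hτ0 n) (hτ0 m) _ ?_ ?_) hB0
    · exact (hτ1 n).le.trans (one_div_le_one_div_of_le (by positivity) (by gcongr))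
    · exact (hτ1 m).le.trans (one_div_le_one_div_of_le (by positivity) (by gcongr))
  obtain ⟨f, hf⟩ := cauchySeq_tendsto_of_complete hcau
  refine ⟨f, ?_⟩
  filter_upwards [hG] with t ht h0
  have h1 : dist (U ⟨t, ht⟩ h0) f ≤ B t := by
    refine le_of_tendsto (tendsto_const_nhds.dist hf) ?_
    filter_upwards [tendsto_one_div_add_atTop_nhds_zero_nat.eventually_lt_const h0] with n hn
    exact hUle _ _ h0 (hτ0 n) _ le_rfl ((hτ1 n).le.trans hn.le)
  have h2 : eLpNorm (fun x => H10L.toL2 s Ω v (t, x) - f x) 2 (volume.restrict Ω) =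
      edist (U ⟨t, ht⟩ h0) f := by
    rw [Lp.edist_def]
    refine eLpNorm_congr_ae ?_
    filter_upwards [(hmem t ht h0).coeFn_toLp] with x hx
    simp only [U, Pi.sub_apply, hx]
  rw [h2, edist_dist]
  exact ENNReal.ofReal_le_ofReal h1

/-! ### Fractional smoothness of the trace. -/

/-- On every interval `(δ, 2δ)` there are slices with a good bound on the gradient. -/
theorem exists_slice_gradient_le {s : ℝ} (hs1 : s ≤ 1) {Ω : Set (Space N)}
    (v : H10L s Ω) {δ : ℝ} (hδ : 0 < δ) {G : Set ℝ}
    (hG : G ∈ ae (volume : Measure ℝ)) :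
    ∃ t ∈ G, δ < t ∧ t < 2 * δ ∧
      IsH10WithGradient Ω (fun x => H10L.toL2 s Ω v (t, x))
        (fun x => (H10L.grad s Ω v (t, x)).snd) ∧
      eLpNorm (fun x => (H10L.grad s Ω v (t, x)).snd) 2 (volume.restrict Ω) ≤
        ENNReal.ofReal (√2 * δ ^ (s - 1) * ‖v‖) := by
  set g := H10L.grad s Ω v
  have hgm : Measurable g := (Lp.stronglyMeasurable g).measurable
  have hsnd : Measurable fun z => (g z).snd :=
    (WithLp.prod_continuous_ofLp 2 ℝ (Space N)).measurable.snd.comp hgm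
  set F : ℝ → ℝ≥0∞ := fun t => ∫⁻ x in Ω, ‖(g (t, x)).snd‖ₑ ^ 2
  have hFm : Measurable F :=
    Measurable.lintegral_prod_right' (f := fun z => ‖(g z).snd‖ₑ ^ 2) (hsnd.enorm.pow_const 2)
  set I := Ioo δ (2 * δ)
  have hIvol : volume I = ENNReal.ofReal δ := by
    rw [Real.volume_Ioo]; congr 1; ring
  have h1 : ENNReal.ofReal (δ ^ (1 - 2 * s) / 2) * ∫⁻ t in I, F t ≤ ‖v‖ₑ ^ 2 := by
    have hv : ‖v‖ₑ ^ 2 = eLpNorm g 2 (weightedMeasure s Ω) ^ 2 := by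
      rw [← Lp.enorm_def]; rfl
    rw [hv, eLpNorm_two_sq, lintegral_weightedMeasure (hgm.enorm.pow_const 2),
      volume_restrict_cylinder, lintegral_prod _ (by fun_prop),
      ← lintegral_const_mul _ hFm]
    have hIsub : I ⊆ Ioi 0 := fun t ht => hδ.trans ht.1
    refine le_trans ?_ (lintegral_mono_set hIsub)
    refine setLIntegral_mono_ae' measurableSet_Ioo (ae_of_all _ fun t ht => ?_)
    have hx : Measurable fun x => ‖(g (t, x)).snd‖ₑ ^ 2 :=
      (hsnd.enorm.pow_const 2).comp measurable_prodMk_left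
    rw [← lintegral_const_mul _ hx]
    refine lintegral_mono fun x => ?_
    have ht0 : 0 < t := hδ.trans ht.1
    gcongr ENNReal.ofReal ?_ * ?_ ^ 2
    -- The sign of `1 - 2s` is unknown. Writing `t^(1-2s) = t^(2-2s) / t`, with `2 - 2s ≥ 0`, gives
    -- the lower bound `δ^(1-2s) / 2` on `(δ, 2δ)` in all cases.
    · have e1 : δ ^ (1 - 2 * s) / 2 = δ ^ (2 - 2 * s) / (2 * δ) := by
        rw [show 2 - 2 * s = (1 - 2 * s) + 1 by ring, Real.rpow_add hδ, Real.rpow_one]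
        field_simp
      have e2 : t ^ (1 - 2 * s) = t ^ (2 - 2 * s) / t := by
        rw [show 2 - 2 * s = (1 - 2 * s) + 1 by ring, Real.rpow_add ht0, Real.rpow_one]
        field_simp
      rw [e1, e2]
      gcongr
      exacts [by linarith, ht.1.le, ht.2.le]
    · rw [← ofReal_norm, ← ofReal_norm]
      exact ENNReal.ofReal_le_ofReal (WithLp.norm_snd_le _ _)
  have hlat := (ae_restrict_iff' measurableSet_Ioi).1 (H10L.isH10L s Ω v).lateral_zero
  set P : Set ℝ := G ∩ {t | t ∈ Ioi (0 : ℝ) →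
    IsH10WithGradient Ω (fun x => H10L.toL2 s Ω v (t, x)) (fun x => (g (t, x)).snd)}
  have hP : P ∈ ae (volume.restrict I) := ae_restrict_le (inter_mem hG hlat)
  have hPI : P ∩ I ∈ ae (volume.restrict I) :=
    inter_mem hP (ae_restrict_mem measurableSet_Ioo)
  have hne : volume.restrict I ≠ 0 := by
    rw [Ne, Measure.restrict_eq_zero, hIvol]; simpa using hδ
  have : IsFiniteMeasure (volume.restrict I) := ⟨by simp [hIvol]⟩
  -- Some admissible time does no worse than the average over the interval, of length `δ`.
  obtain ⟨t, htN, ht⟩ := exists_notMem_null_le_laverage (N := (P ∩ I)ᶜ) hne hFm.aemeasurable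
    (mem_ae_iff.1 hPI)
  rw [notMem_compl_iff] at htN
  refine ⟨t, htN.1.1, htN.2.1, htN.2.2, htN.1.2 (hδ.trans htN.2.1), ?_⟩
  rw [laverage_eq, Measure.restrict_apply_univ, hIvol] at ht
  have h2 : ENNReal.ofReal (δ ^ (2 - 2 * s) / 2) * F t ≤ ‖v‖ₑ ^ 2 := by
    refine le_trans ?_ h1
    have e : δ ^ (2 - 2 * s) / 2 = (δ ^ (1 - 2 * s) / 2) * δ := by
      rw [show 2 - 2 * s = (1 - 2 * s) + 1 by ring, Real.rpow_add hδ, Real.rpow_one]; ring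
    rw [e, ENNReal.ofReal_mul (by positivity), mul_assoc]
    gcongr
    rw [mul_comm]
    exact (ENNReal.le_div_iff_mul_le (Or.inl (by simpa using hδ)) (Or.inl (by simp))).1 ht
  rw [← ENNReal.pow_le_pow_left_iff two_ne_zero, eLpNorm_two_sq]
  change F t ≤ _
  have hd : 0 < δ ^ (2 - 2 * s) / 2 := by positivity
  rw [mul_comm, ← ENNReal.le_div_iff_mul_le (Or.inl (by simpa using hd)) (Or.inl (by simp)),
    ← ofReal_norm, ← ENNReal.ofReal_pow (norm_nonneg _), ← ENNReal.ofReal_div_of_pos hd] at h2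
  refine h2.trans_eq ?_
  rw [← ENNReal.ofReal_pow (by positivity)]
  congr 1
  rw [mul_pow, mul_pow, Real.sq_sqrt (by norm_num), ← Real.rpow_natCast (δ ^ (s - 1)),
    ← Real.rpow_mul hδ.le, show (s - 1) * ((2 : ℕ) : ℝ) = -(2 - 2 * s) by push_cast; ring,
    Real.rpow_neg hδ.le]
  field_simp

/-- The trace is smooth of order `s` in `L²`. -/
theorem eLpNorm_translate_sub_le_of_trace {s : ℝ} (hs0 : 0 < s) (hs1 : s < 1)
    {Ω : Set (Space N)} (hΩ : MeasurableSet Ω) (v : H10L s Ω) (f : Lp ℝ 2 (volume.restrict Ω))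
    (hf : ∀ᵐ t : ℝ, 0 < t →
      eLpNorm (fun x => H10L.toL2 s Ω v (t, x) - f x) 2 (volume.restrict Ω) ≤
        ENNReal.ofReal (‖v‖ * ((2 * t) ^ s / √(2 * s)))) (h : Space N) :
    eLpNorm (fun x => Ω.indicator f (x + h) - Ω.indicator f x) 2 volume ≤
      ENNReal.ofReal ((2 * (4 ^ s / √(2 * s)) + √2) * ‖v‖ * ‖h‖ ^ s) := by
  rcases eq_or_ne h 0 with rfl | hh
  · simp
  set δ := ‖h‖
  have hδ : 0 < δ := norm_pos_iff.2 hh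
  -- The scale `δ = |h|` balances the two errors: replacing `f` by the slice costs order `δ^s`
  -- twice, and translating the slice costs `|h| δ^(s-1) = δ^s`. The constant `4^s` comes from `2t <
  -- 4δ`.
  obtain ⟨t, htG, ht1, ht2, htH, htg⟩ := exists_slice_gradient_le hs1.le v hδ hf
  have ht0 : 0 < t := hδ.trans ht1
  have hvf := htG ht0
  set u : Space N → ℝ := fun x => H10L.toL2 s Ω v (t, x)
  set r : Space N → ℝ := fun x => Ω.indicator u x - Ω.indicator f x
  have hfm : AEStronglyMeasurable (Ω.indicator f) volume :=
    (aestronglyMeasurable_indicator_iff hΩ).2 (Lp.memLp f).1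
  have hum : AEStronglyMeasurable (Ω.indicator u) volume :=
    (aestronglyMeasurable_indicator_iff hΩ).2 htH.1.1
  have hr : AEStronglyMeasurable r volume := hum.sub hfm
  have hrle : eLpNorm r 2 volume ≤ ENNReal.ofReal (4 ^ s / √(2 * s) * ‖v‖ * δ ^ s) := by
    have e : r = Ω.indicator fun x => u x - f x := (indicator_sub Ω u f).symm
    rw [e, eLpNorm_indicator_eq_eLpNorm_restrict hΩ]
    refine hvf.trans (ENNReal.ofReal_le_ofReal ?_)
    calc ‖v‖ * ((2 * t) ^ s / √(2 * s)) ≤ ‖v‖ * ((4 * δ) ^ s / √(2 * s)) := by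
          have : 2 * t ≤ 4 * δ := by linarith
          gcongr
      _ = _ := by rw [Real.mul_rpow (by norm_num) hδ.le]; ring
  have hmp := measurePreserving_add_right (volume : Measure (Space N)) h
  have hrh : AEStronglyMeasurable (fun x => r (x + h)) volume := hr.comp_measurePreserving hmp
  have huh : AEStronglyMeasurable (fun x => Ω.indicator u (x + h) - Ω.indicator u x) volume :=
    (hum.comp_measurePreserving hmp).sub hum
  have e : (fun x => Ω.indicator f (x + h) - Ω.indicator f x) =
      ((fun x => Ω.indicator u (x + h) - Ω.indicator u x) + r) - fun x => r (x + h) := by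
    funext x; simp only [r, Pi.add_apply, Pi.sub_apply]; ring
  rw [e]
  refine (eLpNorm_sub_le (huh.add hr) hrh one_le_two).trans ?_
  rw [eLpNorm_comp_add_right r hr]
  refine (add_le_add ((eLpNorm_add_le huh hr one_le_two).trans (add_le_add
    ((htH.eLpNorm_translate_sub_le hΩ h).trans (mul_le_mul_right htg _)) hrle)) hrle).trans_eq ?_
  rw [← ofReal_norm, ← ENNReal.ofReal_mul (norm_nonneg _),
    ← ENNReal.ofReal_add (by positivity) (by positivity),
    ← ENNReal.ofReal_add (by positivity) (by positivity)]
  congr 1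
  have e2 : δ ^ s = δ * δ ^ (s - 1) := by
    rw [Real.rpow_sub hδ, Real.rpow_one]; field_simp
  change δ * (√2 * δ ^ (s - 1) * ‖v‖) + _ + _ = _
  rw [e2]; ring

/-- A function on a bounded set is controlled by a long translation of its zero extension. -/
theorem exists_eLpNorm_le_translate_sub (hN : 1 ≤ N) {Ω : Set (Space N)} (hΩ : MeasurableSet Ω)
    (hb : Bornology.IsBounded Ω) : ∃ h : Space N, ∀ f : Space N → ℝ,
      eLpNorm f 2 (volume.restrict Ω) ≤
        eLpNorm (fun x => Ω.indicator f (x + h) - Ω.indicator f x) 2 volume := by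
  obtain ⟨R, hR, hΩR⟩ := hb.exists_pos_norm_lt
  -- `Ω` lies in the open ball of radius `R`, so a shift by `2R` along a coordinate axis moves every
  -- point of `Ω` out of it.
  refine ⟨EuclideanSpace.single ⟨0, hN⟩ (2 * R), fun f => ?_⟩
  refine le_trans (le_of_eq ?_) (eLpNorm_mono_measure _ (Measure.restrict_le_self (s := Ω)))
  refine eLpNorm_congr_norm_ae ?_
  filter_upwards [ae_restrict_mem hΩ] with x hx
  have hxh : x + EuclideanSpace.single ⟨0, hN⟩ (2 * R) ∉ Ω := fun hc => by
    have h1 := hΩR _ hc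
    have h2 := hΩR _ hx
    have h3 := norm_sub_le (x + EuclideanSpace.single ⟨0, hN⟩ (2 * R)) x
    rw [add_sub_cancel_left, PiLp.norm_single, Real.norm_of_nonneg (by positivity)] at h3
    linarith
  simp [hx, hxh]

/-! ### The trace as a bounded linear operator. -/

/-- Without this, an essential limit at `0⁺` could be vacuous and traces would not be unique. -/
theorem neBot_nhdsGT_inf_ae : (𝓝[>] (0 : ℝ) ⊓ ae (volume : Measure ℝ)).NeBot := by
  rw [inf_neBot_iff]
  intro U hU G hG
  obtain ⟨ε, hε, hεU⟩ := mem_nhdsGT_iff_exists_Ioo_subset.1 hU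
  have h1 : volume (Ioo (0 : ℝ) ε) ≠ 0 := by
    rw [Real.volume_Ioo]; simpa using hε
  have h2 : volume (Ioo (0 : ℝ) ε ∩ G) ≠ 0 := by
    rwa [measure_inter_conull (mem_ae_iff.1 hG)]
  obtain ⟨t, ht⟩ := nonempty_of_measure_ne_zero h2
  exact ⟨t, hεU ht.1, ht.2⟩

theorem IsTrace.of_rate {Ω : Set (Space N)} {v : ℝ × Space N → ℝ} {f : Space N → ℝ} {s A B : ℝ}
    (hs : 0 < s) (h : ∀ᵐ t : ℝ, 0 < t →
      eLpNorm (fun x => v (t, x) - f x) 2 (volume.restrict Ω) ≤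
        ENNReal.ofReal (A * ((2 * t) ^ s / B))) : IsTrace Ω v f := by
  have h1 : Tendsto (fun t : ℝ => ENNReal.ofReal (A * ((2 * t) ^ s / B)))
      (𝓝[>] (0 : ℝ) ⊓ ae volume) (𝓝 0) := by
    have h2 : Tendsto (fun t : ℝ => A * ((2 * t) ^ s / B)) (𝓝 0) (𝓝 (A * ((2 * 0) ^ s / B))) :=
      Tendsto.const_mul _ (Tendsto.div_const
        ((tendsto_id.const_mul 2).rpow_const (Or.inr hs.le)) _)
    rw [mul_zero, Real.zero_rpow hs.ne', zero_div, mul_zero] at h2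
    rw [← ENNReal.ofReal_zero]
    exact ENNReal.tendsto_ofReal (h2.mono_left (inf_le_left.trans nhdsWithin_le_nhds))
  refine tendsto_of_tendsto_of_tendsto_of_le_of_le' tendsto_const_nhds h1
    (Eventually.of_forall fun _ => zero_le) ?_
  have h3 : ∀ᶠ t in 𝓝[>] (0 : ℝ) ⊓ ae volume, 0 < t :=
    (show ∀ᶠ t in 𝓝[>] (0 : ℝ), 0 < t from self_mem_nhdsWithin).filter_mono inf_le_left
  filter_upwards [h3, h.filter_mono inf_le_right] with t ht h4 using h4 ht

/-- Uniqueness is what makes the chosen traces depend linearly on `v`. -/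
theorem IsTrace.unique {Ω : Set (Space N)} {v : ℝ × Space N → ℝ} (hv : StronglyMeasurable v)
    {f f' : Lp ℝ 2 (volume.restrict Ω)} (h : IsTrace Ω v f) (h' : IsTrace Ω v f') : f = f' := by
  have := neBot_nhdsGT_inf_ae
  have key : ∀ t : ℝ, edist f f' ≤
      eLpNorm (fun x => v (t, x) - f' x) 2 (volume.restrict Ω) +
        eLpNorm (fun x => v (t, x) - f x) 2 (volume.restrict Ω) := fun t => by
    have hm : AEStronglyMeasurable (fun x => v (t, x)) (volume.restrict Ω) :=
      (hv.comp_measurable measurable_prodMk_left).aestronglyMeasurable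
    rw [Lp.edist_def]
    refine le_trans (le_of_eq ?_) (eLpNorm_sub_le (hm.sub (Lp.memLp f').1)
      (hm.sub (Lp.memLp f).1) one_le_two)
    congr 1
    funext x
    simp
  have h0 : edist f f' ≤ 0 :=
    ge_of_tendsto' (by simpa using Tendsto.add h' h) key
  exact edist_le_zero.1 h0

theorem IsTrace.congr {Ω : Set (Space N)} {v v' : ℝ × Space N → ℝ} {f f' : Space N → ℝ}
    (h : IsTrace Ω v f) (hv : v' =ᵐ[volume.restrict (cylinder Ω)] v)
    (hf : f' =ᵐ[volume.restrict Ω] f) : IsTrace Ω v' f' := by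
  have h1 := (ae_restrict_iff' measurableSet_Ioi).1 (ae_slice hv)
  have h3 : ∀ᶠ t in 𝓝[>] (0 : ℝ) ⊓ ae volume, 0 < t :=
    (show ∀ᶠ t in 𝓝[>] (0 : ℝ), 0 < t from self_mem_nhdsWithin).filter_mono inf_le_left
  refine Tendsto.congr' ?_ h
  filter_upwards [h3, Eventually.filter_mono inf_le_right h1] with t ht h4
  refine eLpNorm_congr_ae ?_
  filter_upwards [h4 ht, hf] with x h5 h6
  rw [h5, h6]

theorem IsTrace.add {Ω : Set (Space N)} {v v' : ℝ × Space N → ℝ} (hv : StronglyMeasurable v)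
    (hv' : StronglyMeasurable v') {f f' : Space N → ℝ}
    (hf : AEStronglyMeasurable f (volume.restrict Ω))
    (hf' : AEStronglyMeasurable f' (volume.restrict Ω)) (h : IsTrace Ω v f)
    (h' : IsTrace Ω v' f') : IsTrace Ω (v + v') (f + f') := by
  refine tendsto_of_tendsto_of_tendsto_of_le_of_le tendsto_const_nhds
    (by simpa using Tendsto.add h h') (fun _ => zero_le) fun t => ?_
  have hm : AEStronglyMeasurable (fun x => v (t, x)) (volume.restrict Ω) :=
    (hv.comp_measurable measurable_prodMk_left).aestronglyMeasurable
  have hm' : AEStronglyMeasurable (fun x => v' (t, x)) (volume.restrict Ω) :=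
    (hv'.comp_measurable measurable_prodMk_left).aestronglyMeasurable
  refine le_trans (le_of_eq ?_) (eLpNorm_add_le (hm.sub hf) (hm'.sub hf') one_le_two)
  congr 1
  funext x
  simp only [Pi.add_apply]
  ring

theorem IsTrace.const_smul {Ω : Set (Space N)} {v : ℝ × Space N → ℝ} {f : Space N → ℝ}
    (h : IsTrace Ω v f) (c : ℝ) : IsTrace Ω (c • v) (c • f) := by
  have e : ∀ t : ℝ, eLpNorm (fun x => (c • v) (t, x) - (c • f) x) 2 (volume.restrict Ω) =
      ‖c‖ₑ * eLpNorm (fun x => v (t, x) - f x) 2 (volume.restrict Ω) := fun t => by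
    rw [← eLpNorm_const_smul]
    congr 1
    funext x
    simp [mul_sub]
  unfold IsTrace
  simp only [e]
  simpa using ENNReal.Tendsto.const_mul (a := ‖c‖ₑ) h (Or.inr (by simp))

/-- The trace operator into `L²(Ω)`; traces are smooth of order `s` in `L²`. -/
theorem exists_traceOperator (hN : 1 ≤ N) {s : ℝ} (hs0 : 0 < s) (hs1 : s < 1)
    {Ω : Set (Space N)} (hΩ : IsOpen Ω) (hb : Bornology.IsBounded Ω)
    [IsFiniteMeasure (volume.restrict Ω)] :
    ∃ (T : H10L s Ω →L[ℝ] Lp ℝ 2 (volume.restrict Ω)) (C : ℝ), 0 ≤ C ∧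
      (∀ v, IsTrace Ω (H10L.toL2 s Ω v) (T v)) ∧
      ∀ v h, eLpNorm (fun x => Ω.indicator (T v) (x + h) - Ω.indicator (T v) x) 2 volume ≤
        ENNReal.ofReal (C * ‖v‖ * ‖h‖ ^ s) := by
  choose T₀ hT₀ using exists_trace (s := s) (Ω := Ω) hs0 hΩ
  have htr : ∀ v, IsTrace Ω (H10L.toL2 s Ω v) (T₀ v) := fun v => IsTrace.of_rate hs0 (hT₀ v)
  set C : ℝ := 2 * (4 ^ s / √(2 * s)) + √2
  have hC : 0 ≤ C := by positivity
  have htrans : ∀ v h, eLpNorm (fun x => Ω.indicator (T₀ v) (x + h) - Ω.indicator (T₀ v) x) 2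
      volume ≤ ENNReal.ofReal (C * ‖v‖ * ‖h‖ ^ s) := fun v h =>
    eLpNorm_translate_sub_le_of_trace hs0 hs1 hΩ.measurableSet v (T₀ v) (hT₀ v) h
  have hsm : ∀ v : H10L s Ω, StronglyMeasurable (H10L.toL2 s Ω v) := fun v =>
    Lp.stronglyMeasurable _
  obtain ⟨h, hh⟩ := exists_eLpNorm_le_translate_sub hN hΩ.measurableSet hb
  let L : H10L s Ω →ₗ[ℝ] Lp ℝ 2 (volume.restrict Ω) :=
    { toFun := T₀
      map_add' := fun v v' => IsTrace.unique (hsm _) (htr _) <|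
        ((htr v).add (hsm v) (hsm v') (Lp.memLp _).1 (Lp.memLp _).1 (htr v')).congr
          (by rw [map_add]; exact Lp.coeFn_add _ _) (Lp.coeFn_add _ _)
      map_smul' := fun c v => IsTrace.unique (hsm _) (htr _) <|
        ((htr v).const_smul c).congr (by rw [map_smul]; exact Lp.coeFn_smul _ _)
          (Lp.coeFn_smul _ _) }
  -- Boundedness for the energy norm is the smoothness estimate applied to the one long translation
  -- `h`; it plays the role of a Poincaré inequality.
  refine ⟨L.mkContinuous (C * ‖h‖ ^ s) fun v => ?_, C, hC, htr, htrans⟩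
  rw [Lp.norm_def]
  refine ENNReal.toReal_le_of_le_ofReal (by positivity) ?_
  refine (hh (T₀ v)).trans ((htrans v h).trans_eq ?_)
  congr 1
  ring

/-! ### Compactness by finite rank approximation. -/

theorem finite_image_dyadicIndex {Ω : Set (Space N)} (hb : Bornology.IsBounded Ω) (k : ℕ) :
    (dyadicIndex k '' Ω).Finite := by
  obtain ⟨R, hR, hΩR⟩ := hb.exists_pos_norm_lt
  refine (Set.finite_Icc (fun _ : Fin N => ⌊(2 : ℝ) ^ k * -R⌋)
    (fun _ => ⌊(2 : ℝ) ^ k * R⌋)).subset ?_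
  rintro _ ⟨x, hx, rfl⟩
  have hxi : ∀ i, |x i| ≤ R := fun i => (PiLp.norm_apply_le x i).trans (hΩR x hx).le
  constructor <;> intro i <;> refine Int.floor_mono (mul_le_mul_of_nonneg_left ?_ (by positivity))
  · exact (abs_le.1 (hxi i)).1
  · exact (abs_le.1 (hxi i)).2

/-- Taking dyadic averages of the zero extension is a finite rank operator on a bounded set. -/
theorem exists_isCompactOperator_dyadicAverage {Ω : Set (Space N)} (hΩ : MeasurableSet Ω)
    (hb : Bornology.IsBounded Ω) [IsFiniteMeasure (volume.restrict Ω)] (q : ℝ≥0∞)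
    [Fact (1 ≤ q)] (k : ℕ) :
    ∃ A : Lp ℝ 2 (volume.restrict Ω) →L[ℝ] Lp ℝ q (volume.restrict Ω), IsCompactOperator A ∧
      ∀ f, A f =ᵐ[volume.restrict Ω] dyadicAverage k (Ω.indicator f) := by
  set M : Finset (Fin N → ℤ) := (finite_image_dyadicIndex hb k).toFinset
  have hQ := measurableSet_dyadicCell (N := N) k
  have hQt : ∀ m, (volume.restrict Ω) (dyadicCell k m) ≠ ⊤ := fun m => measure_ne_top _ _
  let a : (Fin N → ℤ) → (Lp ℝ 2 (volume.restrict Ω) →L[ℝ] ℝ) := fun m =>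
    (2 : ℝ) ^ (k * N) • innerSL ℝ (indicatorConstLp 2 (hQ m) (hQt m) (1 : ℝ))
  let e : (Fin N → ℤ) → Lp ℝ q (volume.restrict Ω) := fun m =>
    indicatorConstLp q (hQ m) (hQt m) (1 : ℝ)
  -- Each cube contributes a rank one operator: the average over the cube times the cube's
  -- indicator. Only the finitely many cubes meeting `Ω` matter.
  let B : (Fin N → ℤ) → Lp ℝ 2 (volume.restrict Ω) →L[ℝ] Lp ℝ q (volume.restrict Ω) :=
    fun m => (ContinuousLinearMap.toSpanSingleton ℝ (e m)).comp (a m)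
  have hB : ∀ m, IsCompactOperator (B m) := fun m =>
    (isCompactOperator_of_locallyCompactSpace_rng
      (ContinuousLinearMap.toSpanSingleton ℝ (e m))).comp_clm (a m)
  have ha : ∀ m f, a m f = 2 ^ (k * N) * ∫ y in dyadicCell k m, Ω.indicator f y := fun m f => by
    simp only [a, _root_.smul_apply, innerSL_apply_apply, smul_eq_mul]
    rw [L2.inner_indicatorConstLp_one, Measure.restrict_restrict (hQ m), setIntegral_indicator hΩ]
  refine ⟨∑ m ∈ M, B m, ?_, fun f => ?_⟩
  · exact (compactOperator (RingHom.id ℝ) (Lp ℝ 2 (volume.restrict Ω))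
      (Lp ℝ q (volume.restrict Ω))).sum_mem fun m _ => hB m
  · have h1 : ∀ᵐ x ∂(volume.restrict Ω), ∀ m, e m x = (dyadicCell k m).indicator 1 x :=
      ae_all_iff.2 fun m => indicatorConstLp_coeFn
    have h2 : ∀ᵐ x ∂(volume.restrict Ω), ∀ m, (a m f • e m) x = a m f * e m x :=
      ae_all_iff.2 fun m => Lp.coeFn_smul (a m f) (e m)
    have h3 := Lp.coeFn_finsetSum M fun m => a m f • e m
    rw [_root_.sum_apply]
    change ↑(∑ m ∈ M, a m f • e m) =ᵐ[volume.restrict Ω] _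
    filter_upwards [h1, h2, h3, ae_restrict_mem hΩ] with x h1 h2 h3 hx
    have hxM : dyadicIndex k x ∈ M := (Set.Finite.mem_toFinset _).2 ⟨x, hx, rfl⟩
    rw [h3]
    simp only [Finset.sum_apply, h2, h1]
    rw [Finset.sum_eq_single_of_mem _ hxM]
    · rw [ha, indicator_of_mem (mem_dyadicCell_self k x)]
      simp [dyadicAverage]
    · intro m _ hm
      have hx' : x ∉ dyadicCell k m := fun h => hm (show dyadicIndex k x = m from h).symm
      rw [indicator_of_notMem hx', mul_zero]

/-- Operators into `L²` whose range is smooth of order `s` are compact into `L^q`. -/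
theorem exists_isCompactOperator_of_translate_sub_le {H : Type*} [SeminormedAddCommGroup H]
    [NormedSpace ℝ H] {Ω : Set (Space N)} (hΩ : MeasurableSet Ω)
    (hb : Bornology.IsBounded Ω) [IsFiniteMeasure (volume.restrict Ω)]
    (T : H →L[ℝ] Lp ℝ 2 (volume.restrict Ω)) {s C : ℝ} (hs : 0 < s) (hC : 0 ≤ C)
    (hT : ∀ v h, eLpNorm (fun x => Ω.indicator (T v) (x + h) - Ω.indicator (T v) x) 2 volume ≤
        ENNReal.ofReal (C * ‖v‖ * ‖h‖ ^ s)) {q : ℝ≥0∞} [Fact (1 ≤ q)] (hqt : q ≠ ⊤) (hq : 2 ≤ q)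
    (hqs : (N / 2 : ℝ) * (1 - 2 / q.toReal) < s) :
    ∃ S : H →L[ℝ] Lp ℝ q (volume.restrict Ω),
      (∀ v, S v =ᵐ[volume.restrict Ω] T v) ∧ IsCompactOperator S := by
  have hq2 : 2 ≤ q.toReal := by simpa using ENNReal.toReal_mono hqt hq
  obtain ⟨K, ρ, hK, hρ0, hρ1, hKρ⟩ := exists_eLpNorm_sub_dyadicAverage_le N hs hq2 hqs
  rw [ENNReal.ofReal_toReal hqt] at hKρ
  choose A hAc hA using exists_isCompactOperator_dyadicAverage hΩ hb q
  have hmem : ∀ v, MemLp (Ω.indicator (T v)) 2 volume := fun v =>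
    (memLp_indicator_iff_restrict hΩ).2 (Lp.memLp (T v))
  have herr : ∀ v k, eLpNorm (fun x => T v x - A k (T v) x) q (volume.restrict Ω) ≤
      ENNReal.ofReal (K * (C * ‖v‖) * ρ ^ k) := fun v k => by
    refine le_trans (le_of_eq ?_) ((eLpNorm_mono_measure _ (Measure.restrict_le_self
      (s := Ω))).trans (hKρ (Ω.indicator (T v)) (C * ‖v‖) (by positivity) (hmem v) (hT v) k))
    refine eLpNorm_congr_ae ?_
    filter_upwards [hA k (T v), ae_restrict_mem hΩ] with x h1 h2
    rw [h1, indicator_of_mem h2]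
  -- Higher integrability comes from the error bound at `k = 0`: the error lies in `L^q`, and so
  -- does the average over unit cubes.
  have hLq : ∀ v, MemLp (T v) q (volume.restrict Ω) := fun v => by
    have h1 : MemLp (fun x => T v x - A 0 (T v) x) q (volume.restrict Ω) :=
      ⟨(Lp.memLp (T v)).1.sub (Lp.memLp (A 0 (T v))).1,
        (herr v 0).trans_lt ENNReal.ofReal_lt_top⟩
    have h2 := h1.add (Lp.memLp (A 0 (T v)))
    refine h2.ae_eq (ae_of_all _ fun x => ?_)
    simp
  let L : H →ₗ[ℝ] Lp ℝ q (volume.restrict Ω) :=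
    { toFun := fun v => (hLq v).toLp (T v)
      map_add' := fun v v' => by
        rw [← MemLp.toLp_add, MemLp.toLp_eq_toLp_iff, map_add]
        exact Lp.coeFn_add _ _
      map_smul' := fun c v => by
        rw [RingHom.id_apply, ← MemLp.toLp_const_smul, MemLp.toLp_eq_toLp_iff, map_smul]
        exact Lp.coeFn_smul _ _ }
  have hLA : ∀ k v, ‖L v - A k (T v)‖ ≤ K * C * ρ ^ k * ‖v‖ := fun k v => by
    rw [Lp.norm_def]
    refine ENNReal.toReal_le_of_le_ofReal (by positivity) ?_
    refine le_trans (le_of_eq ?_) ((herr v k).trans_eq (by congr 1; ring))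
    refine eLpNorm_congr_ae ?_
    filter_upwards [Lp.coeFn_sub (L v) (A k (T v)), (hLq v).coeFn_toLp] with x h1 h2
    rw [h1, Pi.sub_apply]
    exact congrArg (· - _) h2
  let S : H →L[ℝ] Lp ℝ q (volume.restrict Ω) := L.mkContinuous (K * C * ρ ^ 0 + ‖(A 0).comp T‖)
    fun v => by
      have h1 := norm_add_le (L v - A 0 (T v)) (A 0 (T v))
      rw [sub_add_cancel] at h1
      have h2 := ((A 0).comp T).le_opNorm v
      rw [ContinuousLinearMap.comp_apply] at h2
      linarith [hLA 0 v]
  refine ⟨S, fun v => (hLq v).coeFn_toLp, ?_⟩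
  -- The error bound is linear in `‖v‖`, so convergence holds in operator norm, and compactness
  -- passes to such limits.
  have hlim : Tendsto (fun k => (A k).comp T) atTop (𝓝 S) := by
    rw [tendsto_iff_norm_sub_tendsto_zero]
    refine squeeze_zero (fun _ => norm_nonneg _) (g := fun k => K * C * ρ ^ k) (fun k => ?_) ?_
    · refine ContinuousLinearMap.opNorm_le_bound _ (by positivity) fun v => ?_
      rw [_root_.sub_apply, norm_sub_rev]
      exact hLA k v
    · simpa using (tendsto_pow_atTop_nhds_zero_of_lt_one hρ0 hρ1).const_mul (K * C)
  exact isCompactOperator_of_tendsto hlim (Eventually.of_forall fun k => (hAc k).comp_clm T)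

/-- For `2s < N` the inequality is a rearrangement of `q < 2N / (N - 2s)`. For `N ≤ 2s` it holds for
every finite `q`, since `1 - 2/q < 1` and `N/2 ≤ s`. -/
theorem half_mul_lt_of_lt_criticalExponent (hN : 1 ≤ N) {s : ℝ} {q : ℝ≥0∞} (hq : 2 ≤ q)
    (hqc : q < criticalExponent N s) : (N / 2 : ℝ) * (1 - 2 / q.toReal) < s := by
  have hqt : q ≠ ⊤ := hqc.ne_top
  have hq2 : 2 ≤ q.toReal := by simpa using ENNReal.toReal_mono hqt hq
  have hN0 : (0 : ℝ) < N := by exact_mod_cast hN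
  have e : (N / 2 : ℝ) * (1 - 2 / q.toReal) = (N * q.toReal - 2 * N) / (2 * q.toReal) := by
    field_simp
  rw [e, div_lt_iff₀ (by positivity)]
  unfold criticalExponent at hqc
  split_ifs at hqc with h
  · have h1 : q.toReal < 2 * N / (N - 2 * s) := by
      rw [← ENNReal.ofReal_toReal hqt] at hqc
      exact (ENNReal.ofReal_lt_ofReal_iff_of_nonneg (by positivity)).1 hqc
    rw [lt_div_iff₀ (by linarith)] at h1
    linarith
  · rw [not_lt] at h
    nlinarith

end FracTrace

theorem mainTheorem4 {N : ℕ} (hN : 1 ≤ N) {s : ℝ} (hs0 : 0 < s) (hs1 : s < 1)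
    {Ω : Set (FracTrace.Space N)} (hΩ : FracTrace.IsBoundedLipschitzDomain Ω) :
    ∃ T : FracTrace.H10L s Ω →L[ℝ] Lp ℝ 2 (volume.restrict Ω),
      (∀ v : FracTrace.H10L s Ω,
        FracTrace.IsTrace Ω (FracTrace.H10L.toL2 s Ω v) (T v)) ∧
      IsCompactOperator T ∧
      ∀ (q : ℝ≥0∞) [Fact (1 ≤ q)], 2 ≤ q → q < FracTrace.criticalExponent N s →
        ∃ Tq : FracTrace.H10L s Ω →L[ℝ] Lp ℝ q (volume.restrict Ω),
          (∀ v : FracTrace.H10L s Ω, Tq v =ᵐ[volume.restrict Ω] T v) ∧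
          IsCompactOperator Tq := by
  have hfin : IsFiniteMeasure (volume.restrict Ω) :=
    ⟨by simpa using hΩ.isBounded.measure_lt_top⟩
  obtain ⟨T, C, hC, htr, hT⟩ :=
    FracTrace.exists_traceOperator hN hs0 hs1 hΩ.isOpen hΩ.isBounded
  refine ⟨T, htr, ?_, fun q _ hq hqc => ?_⟩
  -- At `q = 2` the smoothness condition reads `0 < s`, and the operator produced coincides with
  -- `T`.
  · obtain ⟨S, hST, hS⟩ := FracTrace.exists_isCompactOperator_of_translate_sub_le (q := 2)
      hΩ.isOpen.measurableSet hΩ.isBounded T hs0 hC hT (by simp) le_rfl (by simpa using hs0)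
    have : S = T := ContinuousLinearMap.ext fun v => Lp.ext (hST v)
    rwa [← this]
  · exact FracTrace.exists_isCompactOperator_of_translate_sub_le hΩ.isOpen.measurableSet
      hΩ.isBounded T hs0 hC hT hqc.ne_top hq
      (FracTrace.half_mul_lt_of_lt_criticalExponent hN hq hqc)
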